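/- Let $\eta(\tau)=e^{2\pi i\tau/24}\prod_{n\ge1}(1-e^{2\pi i n\tau})$ be the Dedekind eta function and let $$\mathfrak f(\tau)=\zeta_{48}^{-1}\,\frac{\eta\left(\frac{\tau+1}{2}\right)}{\eta(\tau)},\qquad \zeta_{48}=e^{2\pi i/48},$$ be the Weber function on the upper half-plane $\mathbb H$; it is a modular function of level $48$. Let $\ell$ be a prime not dividing $48$ (that is, $\ell\ge5$). The Weber modular polynomial $\Phi_\ell(x,y)$ is the irreducible polynomial in $\mathbb Z[x,y]$ (determined up to sign) such that $\Phi_\ell(\mathfrak f(\tau),\mathfrak f(\ell\tau))=0$ for all $\tau\in\mathbb H$. Such a polynomial exists, and the coefficient of the monomial $x^iy^j$ in $\Phi_\ell(x,y)$ is nonzero only if $$i+\ell j\equiv \ell+1 \pmod{24}.$$ -/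

import Mathlib

open Complex UpperHalfPlane Polynomial

/-- The Weber function `𝔣(τ) = ζ₄₈⁻¹ η((τ + 1) / 2) / η(τ)`, where `ζ₄₈ = exp(2πi / 48)`
(meaningful for `τ` in the upper half-plane). -/
noncomputable def weberF (τ : ℂ) : ℂ :=
  (cexp (2 * Real.pi * Complex.I / 48))⁻¹ * ModularForm.eta ((τ + 1) / 2) / ModularForm.eta τ

/-- `Φ ∈ ℤ[x, y]` is a modular polynomial of level `ℓ` with respect to the Weber function: it is
irreducible over `ℤ` and satisfies `Φ(𝔣(τ), 𝔣(ℓτ)) = 0` on the upper half-plane. This determines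
`Φ` up to sign. The inner variable of `ℤ[X][X]` is `x`, the outer variable is `y`, so the
coefficient of `x ^ i * y ^ j` is `(Φ.coeff j).coeff i`. -/
structure IsWeberModularPolynomial (ℓ : ℕ) (Φ : Polynomial (Polynomial ℤ)) : Prop where
  irreducible : Irreducible Φ
  relation : ∀ τ : ℍ, Polynomial.aevalAeval (weberF τ) (weberF (ℓ * τ)) Φ = 0

/-!
The Weber function `𝔣` is a Hauptmodul for the theta group `⟨S, T²⟩`, up to a character with
values in the 24th roots of unity: it is holomorphic on `ℍ`, bounded at the cusp `1`, and has a
simple pole at `i∞`. Hence a function with such a character that is holomorphic on `ℍ`, bounded at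
`1` and meromorphic at `i∞` is a polynomial in `𝔣`: subtract multiples of powers of `𝔣` until no
pole is left; the 24th power of the rest is constant.

The conjugates of `𝔣(ℓτ)` are `𝔣(ℓτ)` and the `𝔣((τ + 48k) / ℓ)`, indexed by the projective line
over `𝔽_ℓ`. `S` permutes them and `T²` permutes them up to a common root of unity, so the
coefficients of `∏ (Y - conjugate)` are polynomials in `𝔣(τ)`. This is a monic relation of degree
`ℓ + 1` in `Y`. Any relation is satisfied by all the conjugates, which are distinct near `i∞`, so
there is none of lower degree. It is rational because the monomials in `𝔣(τ)` and `𝔣(ℓτ)` have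
integral expansions at `i∞`: a `ℚ`-linear projection `ℂ → ℚ` applied to the coefficients of a
relation gives another relation.

Replacing `τ` by `τ + 2` multiplies `𝔣(τ)` by `ζ₂₄⁻¹` and `𝔣(ℓτ)` by `ζ₂₄^(-ℓ)`. By uniqueness
this substitution scales the monic relation, which forces `i + ℓj ≡ ℓ(ℓ + 1) ≡ ℓ + 1 (mod 24)` on
every monomial that occurs.
-/

open Filter Topology

section EulerProduct

/-- Euler's product `∏ (1 - q ^ n)` over `n ≥ 1`, as a function of the nome `q`. -/
noncomputable def eulerProd (q : ℂ) : ℂ := ∏' n : ℕ, (1 - q ^ (n + 1))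

/-- The part `∏ (1 - q ^ n)` over odd `n` of Euler's product. -/
noncomputable def oddEulerProd (q : ℂ) : ℂ := ∏' n : ℕ, (1 - q ^ (2 * n + 1))

variable {q : ℂ}

lemma norm_pow_lt_one (hq : ‖q‖ < 1) {n : ℕ} (hn : n ≠ 0) : ‖q ^ n‖ < 1 := by
  rw [norm_pow]
  exact pow_lt_one₀ (norm_nonneg _) hq hn

lemma multipliable_one_sub_pow_comp (hq : ‖q‖ < 1) {g : ℕ → ℕ} (hg : g.Injective) :
    Multipliable fun n ↦ 1 - q ^ g n := by
  simp_rw [sub_eq_add_neg]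
  apply multipliable_one_add_of_summable
  simpa [Function.comp_def] using
    (summable_geometric_of_lt_one (norm_nonneg _) hq).comp_injective hg

lemma eulerProd_eq_oddEulerProd_mul (hq : ‖q‖ < 1) :
    eulerProd q = oddEulerProd q * eulerProd (q ^ 2) := by
  have hodd : Function.Injective fun n : ℕ ↦ 2 * n + 1 := fun a b h ↦ by simpa using h
  have heven : Function.Injective fun n : ℕ ↦ 2 * n + 1 + 1 := fun a b h ↦ by simpa using h
  rw [eulerProd, ← tprod_even_mul_odd (f := fun n ↦ 1 - q ^ (n + 1))
    (multipliable_one_sub_pow_comp hq hodd) (multipliable_one_sub_pow_comp hq heven)]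
  congr 1
  exact tprod_congr fun n ↦ by rw [← pow_mul]; rfl

lemma oddEulerProd_mul_neg (hq : ‖q‖ < 1) :
    oddEulerProd q * oddEulerProd (-q) = oddEulerProd (q ^ 2) := by
  have hodd : Function.Injective fun n : ℕ ↦ 2 * n + 1 := fun a b h ↦ by simpa using h
  rw [oddEulerProd, oddEulerProd, ← (multipliable_one_sub_pow_comp hq hodd).tprod_mul
    (multipliable_one_sub_pow_comp (by simpa using hq) hodd)]
  refine tprod_congr fun n ↦ ?_
  rw [← pow_mul, (odd_two_mul_add_one n).neg_pow]
  ring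

lemma eulerProd_neg_mul (hq : ‖q‖ < 1) :
    eulerProd (-q) * eulerProd q * eulerProd (q ^ 4) = eulerProd (q ^ 2) ^ 3 := by
  have hodd := oddEulerProd_mul_neg hq
  have hsq := eulerProd_eq_oddEulerProd_mul (norm_pow_lt_one hq two_ne_zero)
  rw [eulerProd_eq_oddEulerProd_mul hq, eulerProd_eq_oddEulerProd_mul (q := -q) (by simpa using hq),
    neg_sq, show q ^ 4 = (q ^ 2) ^ 2 by ring]
  linear_combination eulerProd (q ^ 2) ^ 2 * eulerProd ((q ^ 2) ^ 2) * hodd -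
    eulerProd (q ^ 2) ^ 2 * hsq

lemma eulerProd_ne_zero (hq : ‖q‖ < 1) : eulerProd q ≠ 0 := by
  simp_rw [eulerProd, sub_eq_add_neg]
  refine tprod_one_add_ne_zero_of_summable (fun n hn ↦ ?_) ?_
  · have hlt := norm_pow_lt_one hq n.succ_ne_zero
    rw [← sub_eq_zero.1 ((sub_eq_add_neg _ _).trans hn), norm_one] at hlt
    exact hlt.false
  · simpa [Function.comp_def] using
      (summable_geometric_of_lt_one (norm_nonneg _) hq).comp_injective (add_left_injective 1)

lemma tendsto_eulerProd : Tendsto eulerProd (𝓝 0) (𝓝 1) := by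
  have hdiff : DifferentiableAt ℂ eulerProd 0 :=
    ModularForm.differentiableOn_tprod_one_sub_pow.differentiableAt
      (Metric.ball_mem_nhds _ one_pos)
  simpa [eulerProd] using hdiff.continuousAt.tendsto

lemma tendsto_eulerProd_pow {n : ℕ} (hn : n ≠ 0) :
    Tendsto (fun q ↦ eulerProd (q ^ n)) (𝓝 0) (𝓝 1) :=
  tendsto_eulerProd.comp ((continuous_pow n).tendsto' _ _ (zero_pow hn))

end EulerProduct

section Weber

/-- The local parameter `exp (2πiτ / 48)` at the cusp `i∞` in which the Weber function is
expanded. -/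
noncomputable abbrev cuspParam : ℂ → ℂ := Function.Periodic.qParam 48

lemma cuspParam_def (τ : ℂ) : cuspParam τ = cexp (2 * Real.pi * Complex.I * τ / 48) := by
  simp [cuspParam, Function.Periodic.qParam]

lemma cuspParam_ne_zero (τ : ℂ) : cuspParam τ ≠ 0 := Function.Periodic.qParam_ne_zero τ

lemma norm_cuspParam_lt_one {τ : ℂ} (hτ : 0 < τ.im) : ‖cuspParam τ‖ < 1 :=
  Function.Periodic.norm_qParam_lt_one (by norm_num) hτ

lemma cuspParam_add (z w : ℂ) : cuspParam (z + w) = cuspParam z * cuspParam w := by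
  simp only [cuspParam_def, ← Complex.exp_add]
  ring_nf

lemma cuspParam_natCast_mul (n : ℕ) (τ : ℂ) : cuspParam (n * τ) = cuspParam τ ^ n := by
  rw [cuspParam_def, cuspParam_def, ← Complex.exp_nat_mul]
  ring_nf

lemma tendsto_cuspParam : Tendsto (fun τ : ℍ ↦ cuspParam τ) atImInfty (𝓝 0) :=
  qParam_tendsto_atImInfty (by norm_num)

/-- The primitive root of unity `exp (2πi / 24)`. -/
noncomputable def zeta24 : ℂ := cexp (2 * Real.pi * Complex.I / 24)

lemma isPrimitiveRoot_zeta24 : IsPrimitiveRoot zeta24 24 :=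
  Complex.isPrimitiveRoot_exp 24 (by norm_num)

lemma zeta24_ne_zero : zeta24 ≠ 0 := exp_ne_zero _

lemma cuspParam_two_mul_intCast (n : ℤ) : cuspParam (2 * n) = zeta24 ^ n := by
  rw [cuspParam_def, zeta24, ← Complex.exp_int_mul]
  ring_nf

lemma cuspParam_one_pow : cuspParam 1 ^ 24 = -1 := by
  rw [← cuspParam_natCast_mul, cuspParam_def, ← exp_pi_mul_I]
  push_cast
  ring_nf

lemma eta_natCast_mul_div_two (n : ℕ) (τ : ℂ) :
    ModularForm.eta (n * τ / 2) = cuspParam τ ^ n * eulerProd (cuspParam τ ^ (24 * n)) := by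
  have hq : Function.Periodic.qParam 1 (n * τ / 2) = cuspParam τ ^ (24 * n) := by
    rw [← cuspParam_natCast_mul, Function.Periodic.qParam, cuspParam_def]
    push_cast
    ring_nf
  have hq24 : Function.Periodic.qParam 24 (n * τ / 2) = cuspParam τ ^ n := by
    rw [← cuspParam_natCast_mul, Function.Periodic.qParam, cuspParam_def]
    push_cast
    ring_nf
  simp only [ModularForm.eta, ModularForm.eta_q, hq, hq24, eulerProd]

lemma eta_div_two (τ : ℂ) :
    ModularForm.eta (τ / 2) = cuspParam τ * eulerProd (cuspParam τ ^ 24) := by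
  simpa using eta_natCast_mul_div_two 1 τ

lemma eta_eq (τ : ℂ) :
    ModularForm.eta τ = cuspParam τ ^ 2 * eulerProd (cuspParam τ ^ 48) := by
  simpa using eta_natCast_mul_div_two 2 τ

lemma eta_two_mul (τ : ℂ) :
    ModularForm.eta (2 * τ) = cuspParam τ ^ 4 * eulerProd (cuspParam τ ^ 96) := by
  have h := eta_natCast_mul_div_two 4 τ
  rwa [show ((4 : ℕ) : ℂ) * τ / 2 = 2 * τ by push_cast; ring] at h

lemma weberF_mul_cuspParam (τ : ℂ) :
    weberF τ * cuspParam τ = eulerProd (-cuspParam τ ^ 24) / eulerProd (cuspParam τ ^ 48) := by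
  have h48 : cexp (2 * Real.pi * Complex.I / 48) = cuspParam 1 := by rw [cuspParam_def, mul_one]
  have hone := cuspParam_ne_zero 1
  have hτ := cuspParam_ne_zero τ
  rw [weberF, eta_div_two, eta_eq, h48, cuspParam_add, mul_pow, cuspParam_one_pow, mul_neg_one]
  field_simp

lemma weberF_eq (τ : ℂ) :
    weberF τ = eulerProd (-cuspParam τ ^ 24) / (cuspParam τ * eulerProd (cuspParam τ ^ 48)) := by
  rw [mul_comm, ← div_div, ← weberF_mul_cuspParam, mul_div_cancel_right₀ _ (cuspParam_ne_zero τ)]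

lemma tendsto_weberF_mul_cuspParam :
    Tendsto (fun τ : ℍ ↦ weberF τ * cuspParam τ) atImInfty (𝓝 1) := by
  have hneg : Tendsto (fun q : ℂ ↦ eulerProd (-q ^ 24)) (𝓝 0) (𝓝 1) :=
    tendsto_eulerProd.comp (Continuous.tendsto' (by fun_prop) _ _ (by simp))
  have h := (hneg.div (tendsto_eulerProd_pow (n := 48) (by norm_num)) one_ne_zero).comp
    tendsto_cuspParam
  rw [div_one] at h
  exact h.congr fun τ ↦ (weberF_mul_cuspParam τ).symm

lemma weberF_add_two_mul_intCast (τ : ℂ) (n : ℤ) :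
    weberF (τ + 2 * n) = zeta24 ^ (-n) * weberF τ := by
  have h24 : (zeta24 ^ n) ^ 24 = 1 := by
    rw [← zpow_natCast, zpow_comm, zpow_natCast, isPrimitiveRoot_zeta24.pow_eq_one, one_zpow]
  have h48 : (zeta24 ^ n) ^ 48 = 1 := by
    rw [show 48 = 24 * 2 by rfl, pow_mul, h24, one_pow]
  rw [weberF_eq, weberF_eq, cuspParam_add, cuspParam_two_mul_intCast, mul_pow, mul_pow, h24, h48,
    mul_one, mul_one, zpow_neg, mul_comm (cuspParam τ), mul_assoc, div_mul_eq_div_div_swap,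
    div_eq_mul_inv _ (zeta24 ^ n), mul_comm]

lemma weberF_add_forty_eight_mul_intCast (τ : ℂ) (n : ℤ) : weberF (τ + 48 * n) = weberF τ := by
  have h24 : zeta24 ^ (24 : ℤ) = 1 := mod_cast isPrimitiveRoot_zeta24.pow_eq_one
  have h := weberF_add_two_mul_intCast τ (24 * n)
  rw [neg_mul_eq_mul_neg, zpow_mul, h24, one_zpow, one_mul] at h
  rw [← h]
  push_cast
  ring_nf

lemma differentiableAt_weberF {τ : ℂ} (hτ : 0 < τ.im) : DifferentiableAt ℂ weberF τ := by
  have him : 0 < ((τ + 1) / 2).im := by simpa using hτ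
  have hnum : DifferentiableAt ℂ (fun z ↦ ModularForm.eta ((z + 1) / 2)) τ :=
    DifferentiableAt.comp τ (g := ModularForm.eta) (f := fun z ↦ (z + 1) / 2)
      (ModularForm.differentiableAt_eta_of_mem_upperHalfPlaneSet him) (by fun_prop)
  exact (hnum.const_mul _).div (ModularForm.differentiableAt_eta_of_mem_upperHalfPlaneSet hτ)
    (ModularForm.eta_ne_zero hτ)

lemma weberF_eq_eta_quotient {τ : ℂ} (hτ : 0 < τ.im) :
    weberF τ = ModularForm.eta τ ^ 2 / (ModularForm.eta (τ / 2) * ModularForm.eta (2 * τ)) := by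
  have hlt := norm_cuspParam_lt_one hτ
  have h0 := cuspParam_ne_zero τ
  rw [weberF_eq, eta_div_two, eta_eq, eta_two_mul]
  set t := cuspParam τ
  have ht (n : ℕ) (hn : n ≠ 0) : eulerProd (t ^ n) ≠ 0 :=
    eulerProd_ne_zero (norm_pow_lt_one hlt hn)
  have h24 := ht 24 (by norm_num)
  have h48 := ht 48 (by norm_num)
  have h96 := ht 96 (by norm_num)
  have key := eulerProd_neg_mul (norm_pow_lt_one hlt (n := 24) (by norm_num))
  norm_num [← pow_mul] at key
  field_simp
  linear_combination key

lemma sqrt_pow_two (z : ℂ) : Complex.sqrt z ^ 2 = z := by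
  simp [Complex.sqrt]

lemma sqrt_ne_zero {z : ℂ} (hz : z ≠ 0) : Complex.sqrt z ≠ 0 :=
  (pow_ne_zero_iff two_ne_zero).1 (by rwa [sqrt_pow_two])

lemma sqrt_ofReal_mul {r : ℝ} (hr : 0 < r) {z : ℂ} (hz : z ≠ 0) :
    Complex.sqrt (r * z) = √r * Complex.sqrt z := by
  rw [sqrt_eq_exp (mul_ne_zero (ofReal_ne_zero.2 hr.ne') hz), sqrt_eq_exp hz,
    Complex.log_ofReal_mul hr hz, add_div, Complex.exp_add, ← ofReal_ofNat, ← ofReal_div,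
    ← Complex.ofReal_exp, ← Real.log_sqrt hr.le, Real.exp_log (Real.sqrt_pos.2 hr)]

lemma ne_zero_of_im_pos {τ : ℂ} (hτ : 0 < τ.im) : τ ≠ 0 := by
  rintro rfl
  simp at hτ

lemma im_neg_one_div_pos {τ : ℂ} (hτ : 0 < τ.im) : 0 < (-1 / τ).im := by
  have := Complex.normSq_pos.2 (ne_zero_of_im_pos hτ)
  rw [neg_div, one_div, Complex.neg_im, Complex.inv_im, neg_div, neg_neg]
  positivity

lemma eta_neg_one_div {τ : ℂ} (hτ : 0 < τ.im) :
    ModularForm.eta (-1 / τ) =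
      (Complex.sqrt Complex.I)⁻¹ * (Complex.sqrt τ * ModularForm.eta τ) := by
  simpa using ModularForm.eta_comp_eq_csqrt_I_inv hτ

lemma eta_add_one (τ : ℂ) : ModularForm.eta (τ + 1) = zeta24 * ModularForm.eta τ := by
  have h2 : cuspParam 1 ^ 2 = zeta24 := by
    rw [← cuspParam_natCast_mul]
    simpa using cuspParam_two_mul_intCast 1
  have h48 : cuspParam 1 ^ 48 = 1 := by
    rw [show 48 = 24 * 2 by rfl, pow_mul, cuspParam_one_pow, neg_one_sq]
  rw [eta_eq, eta_eq, cuspParam_add, mul_pow, mul_pow, h2, h48]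
  ring_nf

lemma weberF_neg_one_div {τ : ℂ} (hτ : 0 < τ.im) : weberF (-1 / τ) = weberF τ := by
  have h0 := ne_zero_of_im_pos hτ
  have hhalf : 0 < (τ / 2).im := by simpa using hτ
  have htwo : 0 < (2 * τ).im := by simpa using hτ
  have hsqrt : Complex.sqrt (2 * τ) * Complex.sqrt (τ / 2) = τ := by
    have h := sqrt_ofReal_mul (r := 2 ^ 2) (by positivity) (div_ne_zero h0 two_ne_zero)
    rw [Real.sqrt_sq two_pos.le] at h
    rw [show 2 * τ = ((2 ^ 2 : ℝ) : ℂ) * (τ / 2) by push_cast; ring, h, mul_assoc, ← sq,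
      sqrt_pow_two, ofReal_ofNat, mul_div_cancel₀ _ two_ne_zero]
  rw [weberF_eq_eta_quotient hτ, weberF_eq_eta_quotient (im_neg_one_div_pos hτ),
    show -1 / τ / 2 = -1 / (2 * τ) by field_simp, show 2 * (-1 / τ) = -1 / (τ / 2) by field_simp,
    eta_neg_one_div hτ, eta_neg_one_div hhalf, eta_neg_one_div htwo]
  have hI := sqrt_ne_zero Complex.I_ne_zero
  have hsqrt2 := sqrt_ne_zero (mul_ne_zero two_ne_zero h0)
  have hsqrth := sqrt_ne_zero (div_ne_zero h0 two_ne_zero)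
  have hη2 := ModularForm.eta_ne_zero htwo
  have hηh := ModularForm.eta_ne_zero hhalf
  field_simp
  rw [sqrt_pow_two]
  rw [mul_assoc, hsqrt, mul_comm]

lemma weberF_one_add_neg_one_div {τ : ℂ} (hτ : 0 < τ.im) :
    weberF (1 + -1 / τ) = (cexp (2 * Real.pi * Complex.I / 48))⁻¹ * √2 *
      (ModularForm.eta (2 * τ) / ModularForm.eta τ) := by
  have h0 := ne_zero_of_im_pos hτ
  have htwo : 0 < (2 * τ).im := by simpa using hτ
  have hsqrt : Complex.sqrt (2 * τ) = √2 * Complex.sqrt τ := by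
    simpa using sqrt_ofReal_mul two_pos h0
  rw [weberF, show (1 + -1 / τ + 1) / 2 = -1 / (2 * τ) + 1 by field_simp; ring,
    show 1 + -1 / τ = -1 / τ + 1 by ring, eta_add_one, eta_add_one, eta_neg_one_div hτ,
    eta_neg_one_div htwo, hsqrt]
  have hη := ModularForm.eta_ne_zero hτ
  have hI := sqrt_ne_zero Complex.I_ne_zero
  have hsqrt0 := sqrt_ne_zero h0
  have hζ := zeta24_ne_zero
  have hexp := exp_ne_zero (2 * Real.pi * Complex.I / 48)
  field_simp

lemma tendsto_eta_two_mul_div_eta :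
    Tendsto (fun τ : ℍ ↦ ModularForm.eta (2 * τ) / ModularForm.eta τ) atImInfty (𝓝 0) := by
  have h : Tendsto (fun t : ℂ ↦ t ^ 2 * (eulerProd (t ^ 96) / eulerProd (t ^ 48))) (𝓝 0) (𝓝 0) := by
    simpa using ((continuous_pow 2).tendsto (0 : ℂ)).mul
      ((tendsto_eulerProd_pow (n := 96) (by norm_num)).div
        (tendsto_eulerProd_pow (n := 48) (by norm_num)) one_ne_zero)
  refine (h.comp tendsto_cuspParam).congr fun τ ↦ ?_
  have h0 := cuspParam_ne_zero τ
  rw [Function.comp_apply, eta_two_mul, eta_eq]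
  field_simp

lemma isBoundedAtImInfty_weberF_one_add_neg_one_div :
    IsBoundedAtImInfty (fun τ : ℍ ↦ weberF (1 + -1 / (τ : ℂ))) := by
  have hzero : IsZeroAtImInfty (fun τ : ℍ ↦ weberF (1 + -1 / (τ : ℂ))) := by
    simp_rw [fun τ : ℍ ↦ weberF_one_add_neg_one_div τ.im_pos]
    simpa [IsZeroAtImInfty, ZeroAtFilter] using tendsto_eta_two_mul_div_eta.const_mul _
  exact hzero.isBoundedAtImInfty

end Weber

section ThetaGroup

open ModularGroup
open scoped MatrixGroups

lemma coe_S_smul (τ : ℍ) : ((S • τ : ℍ) : ℂ) = -1 / τ := by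
  rw [modular_S_smul]
  simp [neg_div]

lemma coe_T_zpow_smul (n : ℤ) (τ : ℍ) : ((T ^ n • τ : ℍ) : ℂ) = τ + n := by
  rw [modular_T_zpow_smul, coe_vadd]
  simp [add_comm]

lemma coe_T_mul_S_smul (τ : ℍ) : (((T * S) • τ : ℍ) : ℂ) = 1 + -1 / τ := by
  rw [mul_smul, ← zpow_one T, coe_T_zpow_smul, coe_S_smul, add_comm, Int.cast_one]

lemma det_fin_two_eq_one (γ : SL(2, ℤ)) : γ 0 0 * γ 1 1 - γ 0 1 * γ 1 0 = 1 := by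
  rw [← Matrix.det_fin_two, γ.det_coe]

lemma coe_mul_S (γ : SL(2, ℤ)) :
    (γ * S) 0 0 = γ 0 1 ∧ (γ * S) 0 1 = -γ 0 0 ∧ (γ * S) 1 0 = γ 1 1 ∧ (γ * S) 1 1 = -γ 1 0 := by
  simp [coe_S, Matrix.mul_apply, Fin.sum_univ_two]

lemma coe_mul_T_zpow (γ : SL(2, ℤ)) (n : ℤ) :
    (γ * T ^ n) 0 0 = γ 0 0 ∧ (γ * T ^ n) 0 1 = γ 0 1 + n * γ 0 0 ∧
      (γ * T ^ n) 1 0 = γ 1 0 ∧ (γ * T ^ n) 1 1 = γ 1 1 + n * γ 1 0 := by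
  simp [coe_T_zpow, Matrix.mul_apply, Fin.sum_univ_two, mul_comm, add_comm]

/-- The theta group, generated by `S : τ ↦ -1 / τ` and `T ^ 2 : τ ↦ τ + 2`; the Weber function
transforms under it by a character. -/
def thetaGroup : Subgroup SL(2, ℤ) := Subgroup.closure {S, T ^ 2}

lemma S_mem_thetaGroup : S ∈ thetaGroup := Subgroup.subset_closure (by simp)

lemma T_sq_mem_thetaGroup : T ^ 2 ∈ thetaGroup := Subgroup.subset_closure (by simp)

lemma S_mul_S_mul_S_eq_inv : (S * S * S : SL(2, ℤ)) = S⁻¹ := by decide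

lemma T_mul_S_mul_S_eq : (T * S * S : SL(2, ℤ)) = S * S * T := by decide

lemma T_mul_S_mul_T_eq : (T * S * T : SL(2, ℤ)) = S⁻¹ * (T ^ 2)⁻¹ * T * S := by decide

lemma T_mul_S_mul_T_inv_eq : (T * S * T⁻¹ : SL(2, ℤ)) = T ^ 2 * S * T * S := by decide

lemma exists_mem_thetaGroup (γ : SL(2, ℤ)) :
    ∃ δ ∈ thetaGroup, γ = δ ∨ γ = δ * T ∨ γ = δ * T * S := by
  let P (γ : SL(2, ℤ)) : Prop := ∃ δ ∈ thetaGroup, γ = δ ∨ γ = δ * T ∨ γ = δ * T * S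
  have hS : ∀ γ, P γ → P (γ * S) := by
    rintro γ ⟨δ, h, rfl | rfl | rfl⟩
    · exact ⟨_, mul_mem h S_mem_thetaGroup, .inl rfl⟩
    · exact ⟨_, h, .inr (.inr rfl)⟩
    · refine ⟨δ * (S * S), mul_mem h (mul_mem S_mem_thetaGroup S_mem_thetaGroup), .inr (.inl ?_)⟩
      simpa only [mul_assoc] using congrArg (δ * ·) T_mul_S_mul_S_eq
  have hT : ∀ γ, P γ → P (γ * T) := by
    rintro γ ⟨δ, h, rfl | rfl | rfl⟩
    · exact ⟨_, h, .inr (.inl rfl)⟩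
    · exact ⟨_, mul_mem h T_sq_mem_thetaGroup, .inl (by rw [mul_assoc, sq])⟩
    · refine ⟨δ * (S⁻¹ * (T ^ 2)⁻¹), mul_mem h (mul_mem (inv_mem S_mem_thetaGroup)
        (inv_mem T_sq_mem_thetaGroup)), .inr (.inr ?_)⟩
      simpa only [mul_assoc] using congrArg (δ * ·) T_mul_S_mul_T_eq
  have hTinv : ∀ γ, P γ → P (γ * T⁻¹) := by
    rintro γ ⟨δ, h, rfl | rfl | rfl⟩
    · exact ⟨γ * (T ^ 2)⁻¹, mul_mem h (inv_mem T_sq_mem_thetaGroup), .inr (.inl (by group))⟩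
    · exact ⟨_, h, .inl (mul_inv_cancel_right _ _)⟩
    · refine ⟨δ * (T ^ 2 * S), mul_mem h (mul_mem T_sq_mem_thetaGroup S_mem_thetaGroup),
        .inr (.inr ?_)⟩
      simpa only [mul_assoc] using congrArg (δ * ·) T_mul_S_mul_T_inv_eq
  have hmem : γ ∈ Subgroup.closure {S, T} := by
    rw [SpecialLinearGroup.SL2Z_generators]
    trivial
  refine Subgroup.closure_induction_right (p := fun γ _ ↦ P γ) ?_ ?_ ?_ hmem
  · exact ⟨1, one_mem _, .inl rfl⟩
  · rintro x _ y (rfl | rfl) hx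
    exacts [hS _ hx, hT _ hx]
  · rintro x _ y (rfl | rfl) hx
    · rw [← S_mul_S_mul_S_eq_inv, ← mul_assoc, ← mul_assoc]
      exact hS _ (hS _ (hS _ hx))
    · exact hTinv _ hx

/-- `γ` satisfies the parity conditions of the theta group, and the Weber function is multiplied
by `zeta24 ^ e` under `γ`, where `e` is pinned down modulo `8` and modulo `3` by congruences in the
entries of `γ`. -/
structure IsThetaMultiplier (γ : SL(2, ℤ)) (e : ℤ) : Prop where
  even_sub_diag : Even (γ 0 0 - γ 1 1)
  even_sub_antidiag : Even (γ 0 1 - γ 1 0)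
  weberF_smul : ∀ τ : ℍ, weberF (γ • τ : ℍ) = zeta24 ^ e * weberF τ
  even_case : Even (γ 1 0) → 16 ∣ 2 * e - γ 1 1 * (γ 1 0 - γ 0 1)
  odd_case : Odd (γ 1 0) → 16 ∣ 2 * e + γ 1 0 * (γ 0 0 + γ 1 1)
  mod_three : 3 ∣ e - ((γ 0 0 + γ 1 1) * γ 1 0 - γ 0 1 * γ 1 1 * (γ 1 0 ^ 2 - 1))

lemma isThetaMultiplier_one : IsThetaMultiplier 1 0 := by
  constructor <;> simp

namespace IsThetaMultiplier

variable {γ : SL(2, ℤ)} {e : ℤ}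

lemma odd_add_left (h : IsThetaMultiplier γ e) : Odd (γ 0 0 + γ 1 0) := by
  have hdet := congrArg Even (det_fin_two_eq_one γ)
  have hdiag := h.even_sub_diag
  have hanti := h.even_sub_antidiag
  simp only [Int.even_sub, Int.even_mul, Int.not_even_one, eq_iff_iff, iff_false] at *
  rw [← Int.not_even_iff_odd, Int.even_add]
  tauto

lemma odd_iff (h : IsThetaMultiplier γ e) : Odd (γ 1 0) ↔ Even (γ 1 1) := by
  have := h.odd_add_left
  have := h.even_sub_diag
  grind

lemma three_dvd_mul_S (a b c d : ℤ) (h : a * d - b * c = 1) :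
    3 ∣ ((a + d) * c - b * d * (c ^ 2 - 1)) - ((b + -c) * d - -a * -c * (d ^ 2 - 1)) := by
  have key : ∀ a b c d : ZMod 3, a * d - b * c = 1 →
      ((a + d) * c - b * d * (c ^ 2 - 1)) - ((b + -c) * d - -a * -c * (d ^ 2 - 1)) = 0 := by
    decide
  have h3 := key a b c d (mod_cast congrArg (Int.cast : ℤ → ZMod 3) h)
  exact (ZMod.intCast_zmod_eq_zero_iff_dvd _ 3).1 (by push_cast; exact h3)

lemma three_dvd_mul_T_zpow (a b c d s : ℤ) (h : a * d - b * c = 1) :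
    3 ∣ ((a + d) * c - b * d * (c ^ 2 - 1)) - s -
      ((a + (d + 2 * s * c)) * c - (b + 2 * s * a) * (d + 2 * s * c) * (c ^ 2 - 1)) := by
  have key : ∀ a b c d s : ZMod 3, a * d - b * c = 1 →
      ((a + d) * c - b * d * (c ^ 2 - 1)) - s -
        ((a + (d + 2 * s * c)) * c - (b + 2 * s * a) * (d + 2 * s * c) * (c ^ 2 - 1)) = 0 := by
    decide
  have h3 := key a b c d s (mod_cast congrArg (Int.cast : ℤ → ZMod 3) h)
  exact (ZMod.intCast_zmod_eq_zero_iff_dvd _ 3).1 (by push_cast; exact h3)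

lemma mul_S (h : IsThetaMultiplier γ e) : IsThetaMultiplier (γ * S) e := by
  obtain ⟨ha, hb, hc, hd⟩ := coe_mul_S γ
  refine ⟨?_, ?_, fun τ ↦ ?_, ?_, ?_, ?_⟩
  · rw [ha, hd]
    simpa [two_mul] using h.even_sub_antidiag.add (even_two_mul (γ 1 0))
  · rw [hb, hc]
    have := h.even_sub_diag
    grind
  · rw [mul_smul, h.weberF_smul, coe_S_smul, weberF_neg_one_div τ.im_pos]
  · rw [hb, hc, hd]
    intro heven
    exact (h.odd_case (h.odd_iff.2 heven)).trans (dvd_of_eq (by ring))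
  · rw [ha, hc, hd]
    intro hodd
    have heven : Even (γ 1 0) := by
      have := h.odd_iff
      grind
    exact (h.even_case heven).trans (dvd_of_eq (by ring))
  · rw [ha, hb, hc, hd]
    exact (dvd_add h.mod_three (three_dvd_mul_S _ _ _ _ (det_fin_two_eq_one γ))).trans
      (dvd_of_eq (by ring))

lemma sixteen_dvd_even_case {a b c d s : ℤ} (hdet : a * d - b * c = 1) (ha : Odd a) (hb : Even b)
    (hc : Even c) (hs : s ^ 2 = 1) :
    16 ∣ d * (c - b) - 2 * s - (d + 2 * s * c) * (c - (b + 2 * s * a)) := by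
  obtain ⟨B, rfl⟩ := even_iff_exists_two_mul.1 hb
  obtain ⟨C, rfl⟩ := even_iff_exists_two_mul.1 hc
  have hs_odd : Odd s := (Int.odd_pow' two_ne_zero).1 (hs ▸ odd_one)
  obtain ⟨k, hk⟩ : Even (C * (a - s * C)) := by
    rcases Int.even_or_odd C with hC | hC
    · exact hC.mul_right _
    · exact (ha.sub_odd (hs_odd.mul hC)).mul_left _
  exact ⟨s * B * C + k, by linear_combination 8 * hk + 2 * s * hdet + 8 * C * a * hs⟩

lemma sixteen_dvd_odd_case {c : ℤ} (s : ℤ) (hc : Odd c) : 16 ∣ 2 * s * (c ^ 2 - 1) := by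
  obtain ⟨k, hk⟩ := Int.eight_dvd_sq_sub_one_of_odd hc
  exact ⟨s * k, by linear_combination 2 * s * hk⟩

lemma mul_T_zpow (h : IsThetaMultiplier γ e) {s : ℤ} (hs : s ^ 2 = 1) :
    IsThetaMultiplier (γ * T ^ (2 * s)) (e - s) := by
  obtain ⟨ha, hb, hc, hd⟩ := coe_mul_T_zpow γ (2 * s)
  have hdet := det_fin_two_eq_one γ
  refine ⟨?_, ?_, fun τ ↦ ?_, ?_, ?_, ?_⟩
  · rw [ha, hd]
    simpa [sub_add_eq_sub_sub, mul_assoc] using h.even_sub_diag.sub (even_two_mul (s * γ 1 0))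
  · rw [hb, hc]
    simpa [add_sub_right_comm, mul_assoc] using
      h.even_sub_antidiag.add (even_two_mul (s * γ 0 0))
  · have hT := weberF_add_two_mul_intCast τ s
    rw [mul_smul, h.weberF_smul, coe_T_zpow_smul]
    push_cast
    rw [hT, sub_eq_add_neg, zpow_add₀ zeta24_ne_zero, mul_assoc]
  · rw [hb, hc, hd]
    intro heven
    have hodd : Odd (γ 0 0) := by
      have := h.odd_add_left
      grind
    have hb : Even (γ 0 1) := by
      have := h.even_sub_antidiag
      grind
    exact (dvd_add (h.even_case heven) (sixteen_dvd_even_case hdet hodd hb heven hs)).trans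
      (dvd_of_eq (by ring))
  · rw [ha, hc, hd]
    intro hodd
    exact (dvd_add (h.odd_case hodd) (sixteen_dvd_odd_case s hodd)).trans (dvd_of_eq (by ring))
  · rw [ha, hb, hc, hd]
    exact (dvd_add h.mod_three (three_dvd_mul_T_zpow _ _ _ _ s hdet)).trans (dvd_of_eq (by ring))

end IsThetaMultiplier

lemma exists_isThetaMultiplier {γ : SL(2, ℤ)} (hγ : γ ∈ thetaGroup) :
    ∃ e, IsThetaMultiplier γ e := by
  refine Subgroup.closure_induction_right (p := fun γ _ ↦ ∃ e, IsThetaMultiplier γ e)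
    ⟨0, isThetaMultiplier_one⟩ ?_ ?_ hγ
  · rintro γ _ y (rfl | rfl) ⟨e, h⟩
    · exact ⟨e, h.mul_S⟩
    · exact ⟨e - 1, by simpa using h.mul_T_zpow (s := 1) (by norm_num)⟩
  · rintro γ _ y (rfl | rfl) ⟨e, h⟩
    · exact ⟨e, by simpa only [← S_mul_S_mul_S_eq_inv, mul_assoc] using h.mul_S.mul_S.mul_S⟩
    · exact ⟨e - -1, by simpa using h.mul_T_zpow (s := -1) (by norm_num)⟩

lemma mem_thetaGroup_of_odd {γ : SL(2, ℤ)} (hleft : Odd (γ 0 0 + γ 1 0))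
    (hright : Odd (γ 0 1 + γ 1 1)) : γ ∈ thetaGroup := by
  obtain ⟨δ, hδ, hγ⟩ := exists_mem_thetaGroup γ
  obtain ⟨e, h⟩ := exists_isThetaMultiplier hδ
  have hsum : Even (δ 0 1 + δ 0 0 + (δ 1 1 + δ 1 0)) := by
    have := h.even_sub_diag
    have := h.even_sub_antidiag
    grind
  have hT := coe_mul_T_zpow δ 1
  rw [zpow_one] at hT
  rcases hγ with rfl | rfl | rfl
  · exact hδ
  · rw [hT.2.1, hT.2.2.2, one_mul, one_mul] at hright
    exact absurd hsum (Int.not_even_iff_odd.2 hright)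
  · obtain ⟨ha, -, hc, -⟩ := coe_mul_S (δ * T)
    rw [ha, hc, hT.2.1, hT.2.2.2, one_mul, one_mul] at hleft
    exact absurd hsum (Int.not_even_iff_odd.2 hleft)

lemma exists_weberF_smul_of_even {γ : SL(2, ℤ)} (heven : Even (γ 0 0 + γ 1 0)) :
    ∃ e : ℤ, ∀ τ : ℍ, weberF (γ • τ : ℍ) = zeta24 ^ e * weberF ((T * S) • τ : ℍ) := by
  obtain ⟨δ, hδ, hγ⟩ := exists_mem_thetaGroup γ
  obtain ⟨e, h⟩ := exists_isThetaMultiplier hδ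
  rcases hγ with rfl | rfl | rfl
  · exact absurd h.odd_add_left (Int.not_odd_iff_even.2 heven)
  · obtain ⟨ha, -, hc, -⟩ := coe_mul_T_zpow δ 1
    rw [zpow_one] at ha hc
    rw [ha, hc] at heven
    exact absurd h.odd_add_left (Int.not_odd_iff_even.2 heven)
  · exact ⟨e, fun τ ↦ by rw [mul_assoc, mul_smul, h.weberF_smul]⟩

lemma weberF_smul_of_dvd {γ : SL(2, ℤ)} (ha : 48 ∣ γ 0 0) (hd : 48 ∣ γ 1 1) (τ : ℍ) :
    weberF (γ • τ : ℍ) = weberF τ := by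
  have hdet := det_fin_two_eq_one γ
  obtain ⟨k, hk⟩ := ha
  obtain ⟨m, hm⟩ := hd
  have hbc : Odd (γ 0 1 * γ 1 0) :=
    ⟨24 * k * γ 1 1 - 1, by rw [hk] at hdet; linear_combination -hdet⟩
  obtain ⟨hb, hc⟩ := Int.odd_mul.1 hbc
  obtain ⟨e, h⟩ := exists_isThetaMultiplier (mem_thetaGroup_of_odd (γ := γ) (by grind) (by grind))
  obtain ⟨i, hi⟩ := h.odd_case hc
  obtain ⟨j, hj⟩ := h.mod_three
  rw [hk, hm] at hi hj
  have h8 : 8 ∣ e := ⟨i - 3 * γ 1 0 * (k + m), by linarith⟩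
  have h3 : 3 ∣ e := ⟨j + 16 * (k + m) * γ 1 0 - γ 0 1 * (16 * m) * (γ 1 0 ^ 2 - 1), by
    linear_combination hj⟩
  obtain ⟨u, rfl⟩ : 24 ∣ e := by omega
  have h24 : zeta24 ^ (24 : ℤ) = 1 := mod_cast isPrimitiveRoot_zeta24.pow_eq_one
  rw [h.weberF_smul, zpow_mul, h24, one_zpow, one_mul]

end ThetaGroup

section Hauptmodul

open ModularGroup
open scoped MatrixGroups Manifold ModularForm

lemma coe_T_sq_smul (τ : ℍ) : ((T ^ 2 • τ : ℍ) : ℂ) = τ + 2 := by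
  exact_mod_cast coe_T_zpow_smul 2 τ

lemma weberF_S_smul (τ : ℍ) : weberF (S • τ : ℍ) = weberF τ := by
  rw [coe_S_smul, weberF_neg_one_div τ.im_pos]

lemma weberF_T_sq_smul (τ : ℍ) : weberF (T ^ 2 • τ : ℍ) = zeta24⁻¹ * weberF τ := by
  rw [coe_T_sq_smul]
  simpa using weberF_add_two_mul_intCast τ 1

lemma cuspParam_T_sq_smul (τ : ℍ) : cuspParam (T ^ 2 • τ : ℍ) = zeta24 * cuspParam τ := by
  rw [coe_T_sq_smul, cuspParam_add, mul_comm]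
  simpa using congrArg (· * cuspParam τ) (cuspParam_two_mul_intCast 1)

lemma mdifferentiable_cuspParam : MDifferentiable 𝓘(ℂ) 𝓘(ℂ) fun τ : ℍ ↦ cuspParam τ := by
  rw [mdifferentiable_iff]
  refine DifferentiableOn.congr (f := cuspParam) ?_ fun z hz ↦ ?_
  · simp only [funext cuspParam_def]
    fun_prop
  · simp [ofComplex_apply_of_im_pos hz]

lemma mdifferentiable_weberF_comp {g : ℂ → ℂ} (hg : Differentiable ℂ g)
    (him : ∀ z : ℂ, 0 < z.im → 0 < (g z).im) :
    MDifferentiable 𝓘(ℂ) 𝓘(ℂ) fun τ : ℍ ↦ weberF (g τ) := by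
  rw [mdifferentiable_iff]
  refine DifferentiableOn.congr (f := weberF ∘ g) (fun z hz ↦ ?_) fun z hz ↦ ?_
  · exact ((differentiableAt_weberF (him z hz)).comp z (hg z)).differentiableWithinAt
  · simp [ofComplex_apply_of_im_pos hz]

lemma mdifferentiable_weberF : MDifferentiable 𝓘(ℂ) 𝓘(ℂ) fun τ : ℍ ↦ weberF τ :=
  mdifferentiable_weberF_comp (g := id) differentiable_id fun _ ↦ id

lemma tendsto_T_zpow_smul_atImInfty (n : ℤ) :
    Tendsto (fun τ : ℍ ↦ T ^ n • τ) atImInfty atImInfty := by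
  rw [atImInfty, tendsto_comap_iff]
  refine tendsto_comap.congr fun τ ↦ ?_
  rw [Function.comp_apply, ← coe_im, ← coe_im, coe_T_zpow_smul]
  simp

instance : thetaGroup.FiniteIndex := by
  refine Subgroup.finiteIndex_of_le (H := CongruenceSubgroup.Gamma 2) fun γ hγ ↦ ?_
  obtain ⟨ha, hb, hc, hd⟩ := CongruenceSubgroup.Gamma_mem.1 hγ
  refine mem_thetaGroup_of_odd ?_ ?_ <;> rw [← ZMod.intCast_eq_one_iff_odd] <;> simp [*]

lemma eq_const_of_thetaGroup_invariant {G : ℍ → ℂ} (hG : MDifferentiable 𝓘(ℂ) 𝓘(ℂ) G)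
    (hinv : ∀ γ ∈ thetaGroup, ∀ τ, G (γ • τ) = G τ) (hinf : IsBoundedAtImInfty G)
    (hone : IsBoundedAtImInfty fun τ ↦ G ((T * S) • τ)) : ∃ c, G = Function.const ℍ c := by
  have hslash (γ : SL(2, ℤ)) : G ∣[(0 : ℤ)] γ = fun τ ↦ G (γ • τ) := by
    ext τ
    simp [ModularForm.SL_slash_apply]
  refine ModularForm.eq_const_of_weight_zero (𝒢 := thetaGroup)
    { toFun := G
      slash_action_eq' := ?_
      holo' := hG
      bdd_at_cusps' := fun {c} hc ↦ ?_ }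
  · rintro _ ⟨γ, hγ, rfl⟩
    exact (hslash γ).trans (funext (hinv γ hγ))
  · rw [Subgroup.IsArithmetic.isCusp_iff_isCusp_SL2Z] at hc
    rw [OnePoint.isBoundedAt_iff_forall_SL2Z hc]
    intro γ _
    rw [hslash]
    obtain ⟨δ, hδ, rfl | rfl | rfl⟩ := exists_mem_thetaGroup γ
    · simpa only [hinv _ hδ] using hinf
    · have hT := tendsto_T_zpow_smul_atImInfty 1
      rw [zpow_one] at hT
      simp only [mul_smul, hinv δ hδ]
      exact hinf.comp_tendsto hT
    · simpa only [mul_assoc δ, mul_smul δ, hinv δ hδ] using hone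

/-- Invariance of `G` under `S` and equivariance under `T ^ 2` with a 24th root of unity `c` as
multiplier; the Weber function has this property for `c = zeta24⁻¹`. -/
structure HasThetaCharacter (G : ℍ → ℂ) (c : ℂ) : Prop where
  pow_eq_one : c ^ 24 = 1
  smul_S : ∀ τ, G (S • τ) = G τ
  smul_T_sq : ∀ τ, G (T ^ 2 • τ) = c * G τ

lemma pow_smul_eq {G : ℍ → ℂ} {c : ℂ} {γ : SL(2, ℤ)} (h : ∀ τ, G (γ • τ) = c * G τ) (n : ℕ)
    (τ : ℍ) : G (γ ^ n • τ) = c ^ n * G τ := by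
  induction n with
  | zero => simp
  | succ n ih => rw [pow_succ', mul_smul, h, ih, pow_succ', mul_assoc]

namespace HasThetaCharacter

variable {G H : ℍ → ℂ} {c : ℂ}

lemma pow_24_smul (h : HasThetaCharacter G c) {γ : SL(2, ℤ)} (hγ : γ ∈ thetaGroup) (τ : ℍ) :
    G (γ • τ) ^ 24 = G τ ^ 24 := by
  let stab : Subgroup SL(2, ℤ) :=
    { carrier := {γ | ∀ τ, G (γ • τ) ^ 24 = G τ ^ 24}
      one_mem' := fun τ ↦ by rw [one_smul]
      mul_mem' := fun ha hb τ ↦ by rw [mul_smul, ha, hb]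
      inv_mem' := fun {γ} hγ τ ↦ by rw [← hγ, smul_inv_smul] }
  have hle : thetaGroup ≤ stab := by
    refine (Subgroup.closure_le _).2 ?_
    rintro γ (rfl | rfl) τ
    · rw [h.smul_S]
    · rw [h.smul_T_sq, mul_pow, h.pow_eq_one, one_mul]
  exact hle hγ τ

lemma eq_zero (h : HasThetaCharacter G c) (hG : MDifferentiable 𝓘(ℂ) 𝓘(ℂ) G)
    (hinf : IsZeroAtImInfty G) (hone : IsBoundedAtImInfty fun τ ↦ G ((T * S) • τ)) : G = 0 := by
  have hpow : IsZeroAtImInfty (G ^ 24) := by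
    have := hinf.pow 24
    rwa [zero_pow (OfNat.ofNat_ne_zero 24)] at this
  obtain ⟨a, ha⟩ := eq_const_of_thetaGroup_invariant (G := G ^ 24) (hG.pow 24)
    (fun γ hγ τ ↦ h.pow_24_smul hγ τ) hpow.isBoundedAtImInfty
    ((Asymptotics.IsBigO.pow hone 24).congr_right fun τ ↦ by simp)
  rw [ha] at hpow
  have hzero : a = 0 := tendsto_nhds_unique tendsto_const_nhds hpow
  ext τ
  exact pow_eq_zero_iff (OfNat.ofNat_ne_zero 24) |>.1 ((congrFun ha τ).trans hzero)

lemma weberF_pow (n : ℕ) : HasThetaCharacter (fun τ : ℍ ↦ weberF τ ^ n) (zeta24⁻¹ ^ n) where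
  pow_eq_one := by
    rw [← pow_mul, mul_comm, pow_mul, inv_pow, isPrimitiveRoot_zeta24.pow_eq_one, inv_one, one_pow]
  smul_S τ := by rw [weberF_S_smul]
  smul_T_sq τ := by rw [weberF_T_sq_smul, mul_pow]

lemma sub (hG : HasThetaCharacter G c) (hH : HasThetaCharacter H c) :
    HasThetaCharacter (fun τ ↦ G τ - H τ) c where
  pow_eq_one := hG.pow_eq_one
  smul_S τ := by rw [hG.smul_S, hH.smul_S]
  smul_T_sq τ := by rw [hG.smul_T_sq, hH.smul_T_sq, mul_sub]

lemma const_mul (hG : HasThetaCharacter G c) (a : ℂ) : HasThetaCharacter (fun τ ↦ a * G τ) c where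
  pow_eq_one := hG.pow_eq_one
  smul_S τ := by rw [hG.smul_S]
  smul_T_sq τ := by rw [hG.smul_T_sq, mul_left_comm]

lemma mul_cuspParam_pow_T_sq_smul (h : HasThetaCharacter G c) (n : ℕ) (τ : ℍ) :
    G (T ^ 2 • τ) * cuspParam (T ^ 2 • τ : ℍ) ^ n =
      c * zeta24 ^ n * (G τ * cuspParam τ ^ n) := by
  rw [h.smul_T_sq, cuspParam_T_sq_smul]
  ring

lemma periodic_mul_cuspParam_pow (h : HasThetaCharacter G c) (n : ℕ) :
    Function.Periodic ((fun τ : ℍ ↦ G τ * cuspParam τ ^ n) ∘ ofComplex) (48 : ℝ) := by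
  intro w
  by_cases! hw : 0 < w.im
  · have hw' : 0 < (w + (48 : ℝ)).im := by simpa using hw
    have hroot : (c * zeta24 ^ n) ^ 24 = 1 := by
      rw [mul_pow, h.pow_eq_one, ← pow_mul, mul_comm n, pow_mul,
        isPrimitiveRoot_zeta24.pow_eq_one, one_pow, one_mul]
    have hsmul : (⟨w + (48 : ℝ), hw'⟩ : ℍ) = (T ^ 2) ^ 24 • (⟨w, hw⟩ : ℍ) := by
      ext
      rw [← pow_mul, ← zpow_natCast, coe_T_zpow_smul]
      norm_num
    rw [Function.comp_apply, Function.comp_apply, ofComplex_apply_of_im_pos hw',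
      ofComplex_apply_of_im_pos hw, hsmul,
      pow_smul_eq (G := fun τ ↦ G τ * cuspParam τ ^ n) (h.mul_cuspParam_pow_T_sq_smul n),
      hroot, one_mul]
  · have hw' : (w + (48 : ℝ)).im ≤ 0 := by simpa using hw
    rw [Function.comp_apply, Function.comp_apply, ofComplex_apply_of_im_nonpos hw',
      ofComplex_apply_of_im_nonpos hw]

end HasThetaCharacter

lemma norm_cuspParam (τ : ℍ) : ‖cuspParam τ‖ = Real.exp (-2 * Real.pi * τ.im / 48) :=
  Function.Periodic.norm_qParam 48 τ

/-- Functions on the upper half-plane that are holomorphic, meromorphic at the cusp `i∞` and bounded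
at the cusp `1`, to which `T * S` moves `i∞`. -/
structure IsRegularAwayFromInfty (G : ℍ → ℂ) : Prop where
  mdifferentiable : MDifferentiable 𝓘(ℂ) 𝓘(ℂ) G
  growth : ∃ n : ℕ, IsBoundedAtImInfty fun τ ↦ G τ * cuspParam τ ^ n
  bounded : IsBoundedAtImInfty fun τ ↦ G ((T * S) • τ)

lemma isBoundedAtImInfty_mul_cuspParam_pow_mono {G : ℍ → ℂ} {n m : ℕ} (h : n ≤ m)
    (hn : IsBoundedAtImInfty fun τ ↦ G τ * cuspParam τ ^ n) :
    IsBoundedAtImInfty fun τ ↦ G τ * cuspParam τ ^ m := by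
  obtain ⟨k, rfl⟩ := Nat.exists_eq_add_of_le h
  have hk : IsBoundedAtImInfty fun τ : ℍ ↦ cuspParam τ ^ k :=
    (tendsto_cuspParam.pow k).isBigO_one ℝ
  exact (BoundedAtFilter.mul hn hk).congr_left fun τ ↦ by simp [pow_add, mul_assoc]

namespace IsRegularAwayFromInfty

variable {G H : ℍ → ℂ}

lemma const (c : ℂ) : IsRegularAwayFromInfty fun _ ↦ c where
  mdifferentiable := mdifferentiable_const
  growth := ⟨0, (const_boundedAtFilter atImInfty c).congr_left fun τ ↦ by simp⟩
  bounded := const_boundedAtFilter atImInfty c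

lemma add (hG : IsRegularAwayFromInfty G) (hH : IsRegularAwayFromInfty H) :
    IsRegularAwayFromInfty (G + H) where
  mdifferentiable := hG.mdifferentiable.add hH.mdifferentiable
  growth := by
    obtain ⟨n, hn⟩ := hG.growth
    obtain ⟨m, hm⟩ := hH.growth
    exact ⟨max n m, (BoundedAtFilter.add
      (isBoundedAtImInfty_mul_cuspParam_pow_mono (le_max_left n m) hn)
      (isBoundedAtImInfty_mul_cuspParam_pow_mono (le_max_right n m) hm)).congr_left
        fun τ ↦ by simp [add_mul]⟩
  bounded := BoundedAtFilter.add hG.bounded hH.bounded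

lemma mul (hG : IsRegularAwayFromInfty G) (hH : IsRegularAwayFromInfty H) :
    IsRegularAwayFromInfty (G * H) where
  mdifferentiable := hG.mdifferentiable.mul hH.mdifferentiable
  growth := by
    obtain ⟨n, hn⟩ := hG.growth
    obtain ⟨m, hm⟩ := hH.growth
    exact ⟨n + m, (BoundedAtFilter.mul hn hm).congr_left fun τ ↦ by
      simp only [Pi.mul_apply, pow_add, mul_mul_mul_comm]⟩
  bounded := BoundedAtFilter.mul hG.bounded hH.bounded

lemma weberF : IsRegularAwayFromInfty fun τ : ℍ ↦ weberF τ where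
  mdifferentiable := mdifferentiable_weberF
  growth := ⟨1, (tendsto_weberF_mul_cuspParam.isBigO_one ℝ).congr_left fun τ ↦ by simp⟩
  bounded := by
    simp only [coe_T_mul_S_smul]
    exact isBoundedAtImInfty_weberF_one_add_neg_one_div

end IsRegularAwayFromInfty

/-- The algebra of functions that are regular away from `i∞`. -/
def regularSubalgebra : Subalgebra ℂ (ℍ → ℂ) where
  carrier := {G | IsRegularAwayFromInfty G}
  mul_mem' := .mul
  add_mem' := .add
  algebraMap_mem' := .const

lemma IsRegularAwayFromInfty.sub_const_mul_weberF_pow {G : ℍ → ℂ} (hG : IsRegularAwayFromInfty G)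
    (a : ℂ) (n : ℕ) : IsRegularAwayFromInfty fun τ ↦ G τ - a * _root_.weberF τ ^ n :=
  regularSubalgebra.sub_mem hG <| regularSubalgebra.mul_mem (.const a) <|
    regularSubalgebra.pow_mem .weberF n

section LeadingTerm

variable {G : ℍ → ℂ} {c : ℂ} {n : ℕ}

lemma tendsto_valueAtInfty_mul_cuspParam_pow (hG : MDifferentiable 𝓘(ℂ) 𝓘(ℂ) G)
    (hc : HasThetaCharacter G c) (hn : IsBoundedAtImInfty fun τ ↦ G τ * cuspParam τ ^ n) :
    Tendsto (fun τ ↦ G τ * cuspParam τ ^ n) atImInfty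
      (𝓝 (valueAtInfty fun τ ↦ G τ * cuspParam τ ^ n)) := by
  have hdecay := exp_decay_sub_atImInfty (by norm_num) (hc.periodic_mul_cuspParam_pow n)
    (hG.mul (mdifferentiable_cuspParam.pow n)) hn
  have hexp : Tendsto (fun τ : ℍ ↦ Real.exp (-2 * Real.pi * τ.im / 48)) atImInfty (𝓝 0) := by
    simpa [norm_cuspParam] using tendsto_cuspParam.norm
  simpa using (hdecay.trans_tendsto hexp).add_const (valueAtInfty fun τ ↦ G τ * cuspParam τ ^ n)

lemma isBoundedAtImInfty_mul_cuspParam_pow_of_isZeroAtImInfty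
    (hG : MDifferentiable 𝓘(ℂ) 𝓘(ℂ) G) (hc : HasThetaCharacter G c)
    (hn : IsZeroAtImInfty fun τ ↦ G τ * cuspParam τ ^ (n + 1)) :
    IsBoundedAtImInfty fun τ ↦ G τ * cuspParam τ ^ n := by
  have hdecay := hn.exp_decay_atImInfty (by norm_num) (hc.periodic_mul_cuspParam_pow (n + 1))
    (hG.mul (mdifferentiable_cuspParam.pow (n + 1))) hn.isBoundedAtImInfty
  simp only [← norm_cuspParam] at hdecay
  have hquot := hdecay.norm_right.mul
    (Asymptotics.isBigO_refl (fun τ : ℍ ↦ (cuspParam τ)⁻¹) atImInfty).norm_right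
  refine hquot.congr (fun τ ↦ ?_) fun τ ↦ ?_
  · rw [pow_succ, ← mul_assoc, mul_inv_cancel_right₀ (cuspParam_ne_zero τ)]
  · rw [norm_norm, norm_inv, mul_inv_cancel₀ (norm_ne_zero_iff.2 (cuspParam_ne_zero τ)),
      Pi.one_apply]

lemma exists_sub_const_mul_weberF_pow (hG : MDifferentiable 𝓘(ℂ) 𝓘(ℂ) G)
    (hc : HasThetaCharacter G c) (hn : IsBoundedAtImInfty fun τ ↦ G τ * cuspParam τ ^ n) :
    ∃ a : ℂ, HasThetaCharacter (fun τ ↦ G τ - a * weberF τ ^ n) c ∧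
      IsZeroAtImInfty fun τ : ℍ ↦ (G τ - a * weberF τ ^ n) * cuspParam τ ^ n := by
  have hlim := tendsto_valueAtInfty_mul_cuspParam_pow hG hc hn
  set a := valueAtInfty fun τ ↦ G τ * cuspParam τ ^ n
  have hlim' := hlim.comp (tendsto_T_zpow_smul_atImInfty 2)
  have ha : c * zeta24 ^ n * a = a := tendsto_nhds_unique
    ((hlim.const_mul _).congr fun τ ↦ (hc.mul_cuspParam_pow_T_sq_smul n τ).symm) hlim'
  refine ⟨a, ?_, ?_⟩
  · rcases eq_or_ne a 0 with h0 | h0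
    · simpa [h0] using hc
    · have hc' : zeta24⁻¹ ^ n = c := by
        rw [inv_pow]
        exact (eq_inv_of_mul_eq_one_left (mul_right_cancel₀ h0 (by simpa))).symm
      exact hc.sub ((hc' ▸ HasThetaCharacter.weberF_pow n).const_mul a)
  · have := hlim.sub ((tendsto_weberF_mul_cuspParam.pow n).const_mul a)
    rw [one_pow, mul_one, sub_self] at this
    refine this.congr fun τ ↦ ?_
    ring

theorem exists_eq_eval_weberF (hG : IsRegularAwayFromInfty G) (hc : HasThetaCharacter G c) :
    ∃ P : ℂ[X], ∀ τ : ℍ, G τ = P.eval (weberF τ) := by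
  obtain ⟨n, hn⟩ := hG.growth
  induction n generalizing G with
  | zero =>
    obtain ⟨a, hchar, hzero⟩ := exists_sub_const_mul_weberF_pow hG.mdifferentiable hc hn
    have hreg := hG.sub_const_mul_weberF_pow a 0
    have h := hchar.eq_zero hreg.mdifferentiable (by simpa using hzero) hreg.bounded
    exact ⟨C a, fun τ ↦ by simpa [sub_eq_zero] using congrFun h τ⟩
  | succ n ih =>
    obtain ⟨a, hchar, hzero⟩ := exists_sub_const_mul_weberF_pow hG.mdifferentiable hc hn
    have hreg := hG.sub_const_mul_weberF_pow a (n + 1)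
    obtain ⟨P, hP⟩ := ih hreg hchar <|
      isBoundedAtImInfty_mul_cuspParam_pow_of_isZeroAtImInfty hreg.mdifferentiable hchar hzero
    exact ⟨P + C a * X ^ (n + 1), fun τ ↦ by simp [← hP]⟩

end LeadingTerm

end Hauptmodul

section IntegralTaylor

open scoped Nat

lemma tendstoLocallyUniformlyOn_iteratedDeriv {ι : Type*} {l : Filter ι} {F : ι → ℂ → ℂ} {h : ℂ → ℂ}
    {U : Set ℂ} (hU : IsOpen U) (hF : ∀ i, DifferentiableOn ℂ (F i) U)
    (hlim : TendstoLocallyUniformlyOn F h l U) (n : ℕ) :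
    TendstoLocallyUniformlyOn (fun i ↦ iteratedDeriv n (F i)) (iteratedDeriv n h) l U := by
  have hdiff (i : ι) (n : ℕ) : DifferentiableOn ℂ (iteratedDeriv n (F i)) U := by
    induction n with
    | zero => simpa using hF i
    | succ n ih => exact iteratedDeriv_succ (f := F i) ▸ ih.deriv hU
  induction n with
  | zero => simpa using hlim
  | succ n ih =>
    simp only [iteratedDeriv_succ]
    exact ih.deriv (.of_forall fun i ↦ hdiff i n) hU

lemma eq_zero_of_iteratedDeriv_eq_zero {h : ℂ → ℂ} (hh : DifferentiableOn ℂ h (Metric.ball 0 1))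
    (hderiv : ∀ n, iteratedDeriv n h 0 = 0) {t : ℂ} (ht : ‖t‖ < 1) : h t = 0 := by
  have hsum := Complex.hasSum_taylorSeries_on_ball (r := 1) hh (z := t) (by simpa using ht)
  simp only [hderiv, smul_zero] at hsum
  exact hsum.unique hasSum_zero

/-- Holomorphic functions on the unit disc whose Taylor coefficients at the origin are integers. -/
structure HasIntTaylor (h : ℂ → ℂ) : Prop where
  differentiableOn : DifferentiableOn ℂ h (Metric.ball 0 1)
  exists_int : ∀ n : ℕ, ∃ m : ℤ, iteratedDeriv n h 0 = n ! * m

namespace HasIntTaylor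

variable {g h : ℂ → ℂ}

lemma contDiffAt (hh : HasIntTaylor h) (n : WithTop ℕ∞) : ContDiffAt ℂ n h 0 :=
  (hh.differentiableOn.analyticAt (Metric.ball_mem_nhds _ one_pos)).contDiffAt

lemma intCast (m : ℤ) : HasIntTaylor fun _ ↦ (m : ℂ) where
  differentiableOn := differentiableOn_const _
  exists_int n := by
    rw [iteratedDeriv_const]
    split_ifs with h
    · exact ⟨m, by simp [h]⟩
    · exact ⟨0, by simp⟩

lemma id : HasIntTaylor id where
  differentiableOn := differentiableOn_id
  exists_int n := by
    rw [iteratedDeriv_id]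
    split_ifs with h h'
    · exact ⟨0, by simp⟩
    · exact ⟨1, by simp [h']⟩
    · exact ⟨0, by simp⟩

lemma add (hg : HasIntTaylor g) (hh : HasIntTaylor h) : HasIntTaylor (g + h) where
  differentiableOn := hg.differentiableOn.add hh.differentiableOn
  exists_int n := by
    obtain ⟨a, ha⟩ := hg.exists_int n
    obtain ⟨b, hb⟩ := hh.exists_int n
    refine ⟨a + b, ?_⟩
    rw [iteratedDeriv_add (hg.contDiffAt _) (hh.contDiffAt _), ha, hb, Int.cast_add, mul_add]

lemma mul (hg : HasIntTaylor g) (hh : HasIntTaylor h) : HasIntTaylor (g * h) where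
  differentiableOn := hg.differentiableOn.mul hh.differentiableOn
  exists_int n := by
    choose a ha using hg.exists_int
    choose b hb using hh.exists_int
    refine ⟨∑ i ∈ Finset.range (n + 1), a i * b (n - i), ?_⟩
    rw [iteratedDeriv_mul (hg.contDiffAt _) (hh.contDiffAt _)]
    push_cast
    rw [Finset.mul_sum]
    refine Finset.sum_congr rfl fun i hi ↦ ?_
    rw [ha, hb, ← Nat.choose_mul_factorial_mul_factorial (Finset.mem_range_succ_iff.1 hi)]
    push_cast
    ring

/-- The ring of holomorphic functions on the unit disc with integral Taylor coefficients. -/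
def subalgebra : Subalgebra ℤ (ℂ → ℂ) where
  carrier := {h | HasIntTaylor h}
  mul_mem' := .mul
  add_mem' := .add
  algebraMap_mem' := intCast

lemma pow (hg : HasIntTaylor g) (n : ℕ) : HasIntTaylor (g ^ n) := subalgebra.pow_mem hg n

lemma of_tendstoLocallyUniformlyOn {ι : Type*} {l : Filter ι} [l.NeBot] {F : ι → ℂ → ℂ}
    (hF : ∀ i, HasIntTaylor (F i)) (hlim : TendstoLocallyUniformlyOn F h l (Metric.ball 0 1)) :
    HasIntTaylor h where
  differentiableOn :=
    hlim.differentiableOn (.of_forall fun i ↦ (hF i).differentiableOn) Metric.isOpen_ball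
  exists_int n := by
    have hderiv := (tendstoLocallyUniformlyOn_iteratedDeriv Metric.isOpen_ball
      (fun i ↦ (hF i).differentiableOn) hlim n).tendsto_at (Metric.mem_ball_self one_pos)
    have hfac : (n ! : ℂ) ≠ 0 := mod_cast n.factorial_ne_zero
    obtain ⟨m, hm⟩ : iteratedDeriv n h 0 / n ! ∈ Set.range ((↑) : ℤ → ℂ) := by
      refine Complex.isClosed_range_intCast.mem_of_tendsto (hderiv.div_const _)
        (.of_forall fun i ↦ ?_)
      obtain ⟨m, hm⟩ := (hF i).exists_int n
      exact ⟨m, by rw [hm, mul_div_cancel_left₀ _ hfac]⟩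
    exact ⟨m, by rw [hm, mul_div_cancel₀ _ hfac]⟩

lemma eulerProd_comp (hg : HasIntTaylor g)
    (hmap : Set.MapsTo g (Metric.ball 0 1) (Metric.ball 0 1)) :
    HasIntTaylor fun t ↦ eulerProd (g t) := by
  have hlim := ModularForm.multipliableLocallyUniformlyOn_one_sub_pow.hasProdLocallyUniformlyOn.comp
    g hmap hg.differentiableOn.continuousOn
  refine of_tendstoLocallyUniformlyOn (fun s ↦ ?_) hlim
  have hprod : HasIntTaylor (∏ i ∈ s, (1 - g ^ (i + 1))) :=
    subalgebra.prod_mem fun i _ ↦ subalgebra.sub_mem subalgebra.one_mem (hg.pow _)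
  convert hprod using 1
  ext t
  simp

section LinearRelation

variable {ι : Type*} {s : Finset ι} {F : ι → ℂ → ℂ}

lemma differentiableOn_sum (hF : ∀ i, HasIntTaylor (F i)) (c : ι → ℂ) :
    DifferentiableOn ℂ (fun t ↦ ∑ i ∈ s, c i * F i t) (Metric.ball 0 1) :=
  DifferentiableOn.fun_sum fun i _ ↦ (hF i).differentiableOn.const_mul _

lemma exists_iteratedDeriv_sum (hF : ∀ i, HasIntTaylor (F i)) (n : ℕ) :
    ∃ a : ι → ℤ, ∀ c : ι → ℂ,
      iteratedDeriv n (fun t ↦ ∑ i ∈ s, c i * F i t) 0 = n ! * ∑ i ∈ s, c i * a i := by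
  choose a ha using fun i ↦ (hF i).exists_int n
  refine ⟨a, fun c ↦ ?_⟩
  rw [iteratedDeriv_fun_sum fun i _ ↦ contDiffAt_const.mul ((hF i).contDiffAt _), Finset.mul_sum]
  refine Finset.sum_congr rfl fun i _ ↦ ?_
  rw [iteratedDeriv_const_mul _ ((hF i).contDiffAt _), ha, mul_left_comm]

lemma iteratedDeriv_sum_eq_zero (hF : ∀ i, HasIntTaylor (F i)) {c : ι → ℂ}
    (hrel : ∀ t : ℂ, t ≠ 0 → ‖t‖ < 1 → ∑ i ∈ s, c i * F i t = 0) (n : ℕ) :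
    iteratedDeriv n (fun t ↦ ∑ i ∈ s, c i * F i t) 0 = 0 := by
  have hball : Metric.ball (0 : ℂ) 1 ∈ 𝓝 0 := Metric.ball_mem_nhds _ one_pos
  have hpunctured : (fun t ↦ ∑ i ∈ s, c i * F i t) =ᶠ[𝓝[≠] 0] fun _ ↦ 0 := by
    filter_upwards [self_mem_nhdsWithin, mem_nhdsWithin_of_mem_nhds hball] with t ht ht'
    exact hrel t ht (by simpa using ht')
  have hzero : (fun t ↦ ∑ i ∈ s, c i * F i t) =ᶠ[𝓝 0] fun _ ↦ 0 :=
    (ContinuousAt.eventuallyEq_nhds_iff_eventuallyEq_nhdsNE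
      ((differentiableOn_sum hF c).differentiableAt hball).continuousAt continuousAt_const).1
        hpunctured
  rw [hzero.iteratedDeriv_eq n, iteratedDeriv_fun_const_zero]

/-- A complex linear relation is the same as the vanishing of the corresponding combinations of
integral Taylor coefficients, and these are preserved by every `ℚ`-linear functional. -/
lemma sum_map_mul_eq_zero (L : ℂ →ₗ[ℚ] ℚ) (hF : ∀ i, HasIntTaylor (F i)) {c : ι → ℂ}
    (hrel : ∀ t : ℂ, t ≠ 0 → ‖t‖ < 1 → ∑ i ∈ s, c i * F i t = 0) {t : ℂ} (ht : ‖t‖ < 1) :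
    ∑ i ∈ s, (L (c i) : ℂ) * F i t = 0 := by
  refine eq_zero_of_iteratedDeriv_eq_zero (h := fun t ↦ ∑ i ∈ s, (L (c i) : ℂ) * F i t)
    (differentiableOn_sum hF _) (fun n ↦ ?_) ht
  obtain ⟨a, ha⟩ := exists_iteratedDeriv_sum (s := s) hF n
  have hcoeff : ∑ i ∈ s, c i * a i = 0 := by
    have := iteratedDeriv_sum_eq_zero hF hrel n
    rw [ha] at this
    exact (mul_eq_zero.1 this).resolve_left (mod_cast n.factorial_ne_zero)
  have hmap : ∑ i ∈ s, L (c i) * a i = 0 := by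
    simpa only [← zsmul_eq_mul', map_sum, map_zsmul, map_zero] using congrArg L hcoeff
  rw [ha]
  exact_mod_cast mul_eq_zero_of_right _ hmap

end LinearRelation

end HasIntTaylor

end IntegralTaylor

section Rationality

lemma mapsTo_mul_pow_ball {σ : ℂ} (hσ : ‖σ‖ = 1) {n : ℕ} (hn : n ≠ 0) :
    Set.MapsTo (fun t : ℂ ↦ σ * t ^ n) (Metric.ball 0 1) (Metric.ball 0 1) := by
  intro t ht
  rw [mem_ball_zero_iff] at ht ⊢
  rw [norm_mul, hσ, one_mul]
  exact norm_pow_lt_one ht hn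

/-- The numerator of `weberF` as a function of the local parameter at `i∞`. -/
noncomputable def weberNum (q : ℂ) : ℂ := eulerProd (-q ^ 24)

/-- The denominator of `weberF` as a function of the local parameter at `i∞`. -/
noncomputable def weberDen (q : ℂ) : ℂ := q * eulerProd (q ^ 48)

lemma weberF_eq_div (τ : ℂ) : weberF τ = weberNum (cuspParam τ) / weberDen (cuspParam τ) :=
  weberF_eq τ

lemma weberDen_ne_zero {q : ℂ} (hq0 : q ≠ 0) (hq : ‖q‖ < 1) : weberDen q ≠ 0 :=
  mul_ne_zero hq0 (eulerProd_ne_zero (norm_pow_lt_one hq (by norm_num)))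

lemma hasIntTaylor_weberNum_pow {n : ℕ} (hn : n ≠ 0) :
    HasIntTaylor fun q ↦ weberNum (q ^ n) := by
  refine HasIntTaylor.eulerProd_comp (g := fun q ↦ -(q ^ n) ^ 24)
    (HasIntTaylor.subalgebra.neg_mem ((HasIntTaylor.id.pow n).pow 24)) ?_
  simpa [pow_mul] using mapsTo_mul_pow_ball (σ := -1) (by simp) (mul_ne_zero hn (by norm_num))

lemma hasIntTaylor_weberDen_pow {n : ℕ} (hn : n ≠ 0) :
    HasIntTaylor fun q ↦ weberDen (q ^ n) := by
  refine (HasIntTaylor.id.pow n).mul (HasIntTaylor.eulerProd_comp (g := fun q ↦ (q ^ n) ^ 48)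
    ((HasIntTaylor.id.pow n).pow 48) ?_)
  simpa [pow_mul] using mapsTo_mul_pow_ball (σ := 1) (by simp) (mul_ne_zero hn (by norm_num))

lemma exists_cuspParam_eq {q : ℂ} (hq0 : q ≠ 0) (hq : ‖q‖ < 1) : ∃ τ : ℍ, cuspParam τ = q :=
  ⟨⟨Function.Periodic.invQParam 48 q,
    Function.Periodic.im_invQParam_pos_of_norm_lt_one (by norm_num) hq hq0⟩,
    Function.Periodic.qParam_right_inv (by norm_num) hq0⟩

/-- The ideal of all complex polynomial relations between `weberF τ` (the inner variable) and
`weberF (ℓ * τ)` (the outer variable). -/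
noncomputable def weberRelations (ℓ : ℕ) : Ideal ℂ[X][X] :=
  ⨅ τ : ℍ, RingHom.ker (evalEvalRingHom (weberF τ) (weberF (ℓ * τ)))

lemma mem_weberRelations {ℓ : ℕ} {P : ℂ[X][X]} :
    P ∈ weberRelations ℓ ↔ ∀ τ : ℍ, P.evalEval (weberF τ) (weberF (ℓ * τ)) = 0 := by
  simp [weberRelations]

/-- The monomial `x ^ i * y ^ j` at `x = weberF τ` and `y = weberF (ℓ * τ)`, in terms of the local
parameter at `i∞` and with the denominators of `x ^ A * y ^ B` cleared. -/
noncomputable def weberMonomial (ℓ A B i j : ℕ) (q : ℂ) : ℂ :=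
  weberNum (q ^ 1) ^ i * weberDen (q ^ 1) ^ (A - i) *
    (weberNum (q ^ ℓ) ^ j * weberDen (q ^ ℓ) ^ (B - j))

lemma hasIntTaylor_weberMonomial {ℓ : ℕ} (hℓ : ℓ ≠ 0) (A B i j : ℕ) :
    HasIntTaylor (weberMonomial ℓ A B i j) :=
  (((hasIntTaylor_weberNum_pow one_ne_zero).pow i).mul
    ((hasIntTaylor_weberDen_pow one_ne_zero).pow (A - i))).mul
      (((hasIntTaylor_weberNum_pow hℓ).pow j).mul ((hasIntTaylor_weberDen_pow hℓ).pow (B - j)))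

lemma weberMonomial_cuspParam {ℓ A B i j : ℕ} (hℓ : ℓ ≠ 0) (hi : i ≤ A) (hj : j ≤ B) (τ : ℍ) :
    weberMonomial ℓ A B i j (cuspParam τ) =
      weberDen (cuspParam τ) ^ A * weberDen (cuspParam τ ^ ℓ) ^ B *
        (weberF τ ^ i * weberF (ℓ * τ) ^ j) := by
  have hq := norm_cuspParam_lt_one τ.im_pos
  have hx := weberDen_ne_zero (cuspParam_ne_zero τ) hq
  have hy := weberDen_ne_zero (pow_ne_zero ℓ (cuspParam_ne_zero τ)) (norm_pow_lt_one hq hℓ)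
  simp only [weberMonomial, weberF_eq_div, cuspParam_natCast_mul, pow_one, div_pow]
  rw [pow_sub₀ _ hx hi, pow_sub₀ _ hy hj]
  field_simp

lemma evalEval_eq_sum {R : Type*} [CommSemiring R] {P : R[X][X]} {A B : ℕ} (hB : P.natDegree < B)
    (hA : ∀ j, (P.coeff j).natDegree < A) (x y : R) : P.evalEval x y =
      ∑ p ∈ Finset.range A ×ˢ Finset.range B, (P.coeff p.2).coeff p.1 * (x ^ p.1 * y ^ p.2) := by
  rw [Finset.sum_product_right, evalEval, eval_eq_sum_range' hB, eval_finsetSum]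
  refine Finset.sum_congr rfl fun j _ ↦ ?_
  rw [eval_mul, eval_pow, eval_C, eval_eq_sum_range' (hA j), Finset.sum_mul]
  exact Finset.sum_congr rfl fun i _ ↦ mul_assoc _ _ _

lemma mem_weberRelations_iff_sum {ℓ : ℕ} (hℓ : ℓ ≠ 0) {P : ℂ[X][X]} {A B : ℕ}
    (hB : P.natDegree < B) (hA : ∀ j, (P.coeff j).natDegree < A) :
    P ∈ weberRelations ℓ ↔ ∀ q : ℂ, q ≠ 0 → ‖q‖ < 1 →
      ∑ p ∈ Finset.range A ×ˢ Finset.range B,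
        (P.coeff p.2).coeff p.1 * weberMonomial ℓ A B p.1 p.2 q = 0 := by
  have hclear (τ : ℍ) : ∑ p ∈ Finset.range A ×ˢ Finset.range B,
      (P.coeff p.2).coeff p.1 * weberMonomial ℓ A B p.1 p.2 (cuspParam τ) =
        weberDen (cuspParam τ) ^ A * weberDen (cuspParam τ ^ ℓ) ^ B *
          P.evalEval (weberF τ) (weberF (ℓ * τ)) := by
    rw [evalEval_eq_sum hB hA, Finset.mul_sum]
    refine Finset.sum_congr rfl fun p hp ↦ ?_
    simp only [Finset.mem_product, Finset.mem_range] at hp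
    rw [weberMonomial_cuspParam hℓ hp.1.le hp.2.le, mul_left_comm]
  rw [mem_weberRelations]
  constructor
  · intro h q hq0 hq
    obtain ⟨τ, rfl⟩ := exists_cuspParam_eq hq0 hq
    rw [hclear, h, mul_zero]
  · intro h τ
    have hq := norm_cuspParam_lt_one τ.im_pos
    have hzero := h _ (cuspParam_ne_zero τ) hq
    rw [hclear] at hzero
    refine (mul_eq_zero.1 hzero).resolve_left (mul_ne_zero ?_ ?_) <;> refine pow_ne_zero _ ?_
    · exact weberDen_ne_zero (cuspParam_ne_zero τ) hq
    · exact weberDen_ne_zero (pow_ne_zero ℓ (cuspParam_ne_zero τ)) (norm_pow_lt_one hq hℓ)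

section MapCoeff

variable {R S : Type*} [Semiring R] [Semiring S]

/-- The additive map between polynomials that applies `f` to every coefficient; unlike in
`Polynomial.map`, `f` need not be multiplicative. -/
noncomputable def mapCoeff (f : R →+ S) : R[X] →+ S[X] where
  toFun p := p.sum fun n a ↦ monomial n (f a)
  map_zero' := sum_zero_index _
  map_add' p q := sum_add_index p q _ (by simp) (by simp)

variable (f : R →+ S)

@[simp]
lemma coeff_mapCoeff (p : R[X]) (n : ℕ) : (mapCoeff f p).coeff n = f (p.coeff n) := by
  simp +contextual [mapCoeff, sum_def, coeff_monomial]

lemma natDegree_mapCoeff_le (p : R[X]) : (mapCoeff f p).natDegree ≤ p.natDegree := by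
  rw [natDegree_le_iff_coeff_eq_zero]
  intro n hn
  rw [coeff_mapCoeff, coeff_eq_zero_of_natDegree_lt hn, map_zero]

variable {f}

lemma mapCoeff_one (hf : f 1 = 1) : mapCoeff f 1 = 1 := by
  ext n
  rw [coeff_mapCoeff, coeff_one, coeff_one]
  split_ifs <;> simp [hf]

lemma monic_mapCoeff (hf : f 1 = 1) {p : R[X]} (hp : p.Monic) : (mapCoeff f p).Monic :=
  monic_of_natDegree_le_of_coeff_eq_one p.natDegree (natDegree_mapCoeff_le f p) <| by
    rw [coeff_mapCoeff, hp.coeff_natDegree, hf]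

lemma natDegree_mapCoeff [Nontrivial S] (hf : f 1 = 1) {p : R[X]} (hp : p.Monic) :
    (mapCoeff f p).natDegree = p.natDegree :=
  natDegree_eq_of_le_of_coeff_ne_zero (natDegree_mapCoeff_le f p) <| by
    rw [coeff_mapCoeff, hp.coeff_natDegree, hf]
    exact one_ne_zero

end MapCoeff

lemma exists_natDegree_coeff_lt {R : Type*} [Semiring R] (P : R[X][X]) :
    ∃ A, ∀ j, (P.coeff j).natDegree < A := by
  refine ⟨P.support.sup (fun j ↦ (P.coeff j).natDegree) + 1, fun j ↦ Nat.lt_succ_of_le ?_⟩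
  by_cases hj : j ∈ P.support
  · exact Finset.le_sup (f := fun j ↦ (P.coeff j).natDegree) hj
  · simp [notMem_support_iff.1 hj]

lemma map_mapCoeff_mem_weberRelations {ℓ : ℕ} (hℓ : ℓ ≠ 0) {P : ℂ[X][X]}
    (hP : P ∈ weberRelations ℓ) (L : ℂ →ₗ[ℚ] ℚ) :
    (mapCoeff (mapCoeff L.toAddMonoidHom) P).map (mapRingHom (algebraMap ℚ ℂ)) ∈
      weberRelations ℓ := by
  obtain ⟨A, hA⟩ := exists_natDegree_coeff_lt P
  have hB := P.natDegree.lt_succ_self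
  rw [mem_weberRelations_iff_sum hℓ hB hA] at hP
  refine (mem_weberRelations_iff_sum (A := A) (B := P.natDegree + 1) hℓ ?_ fun j ↦ ?_).2
    fun q _ hq ↦ ?_
  · exact (natDegree_map_le.trans (natDegree_mapCoeff_le _ _)).trans_lt hB
  · simp only [coeff_map, coe_mapRingHom, coeff_mapCoeff]
    exact (natDegree_map_le.trans (natDegree_mapCoeff_le _ _)).trans_lt (hA j)
  · simpa using HasIntTaylor.sum_map_mul_eq_zero L
      (fun p : ℕ × ℕ ↦ hasIntTaylor_weberMonomial hℓ A (P.natDegree + 1) p.1 p.2) hP hq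

lemma exists_rat_monic_map_mem_weberRelations {ℓ : ℕ} (hℓ : ℓ ≠ 0) {P : ℂ[X][X]} (hmonic : P.Monic)
    (hP : P ∈ weberRelations ℓ) :
    ∃ Q : ℚ[X][X], Q.Monic ∧ Q.natDegree = P.natDegree ∧
      Q.map (mapRingHom (algebraMap ℚ ℂ)) ∈ weberRelations ℓ := by
  obtain ⟨L, hL⟩ := (Algebra.linearMap ℚ ℂ).exists_leftInverse_of_injective
    (LinearMap.ker_eq_bot.2 (algebraMap ℚ ℂ).injective)
  have hL1 : mapCoeff L.toAddMonoidHom 1 = 1 :=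
    mapCoeff_one (by simpa using LinearMap.congr_fun hL 1)
  exact ⟨_, monic_mapCoeff hL1 hmonic, natDegree_mapCoeff hL1 hmonic,
    map_mapCoeff_mem_weberRelations hℓ hP L⟩

end Rationality

section IsogenousPoints

open ModularGroup
open scoped MatrixGroups

variable (ℓ : ℕ) [NeZero ℓ]

/-- The point `ℓ * τ`. -/
def mulPoint (τ : ℍ) : ℍ :=
  ⟨ℓ * τ, by simpa using mul_pos (Nat.cast_pos.2 (NeZero.pos ℓ)) τ.im_pos⟩

/-- The point `(τ + n) / ℓ`. -/
noncomputable def divPoint (n : ℤ) (τ : ℍ) : ℍ :=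
  ⟨(τ + n) / ℓ, by
    simpa [Complex.div_natCast_im] using div_pos τ.im_pos (Nat.cast_pos.2 (NeZero.pos ℓ))⟩

lemma coe_mulPoint (τ : ℍ) : (mulPoint ℓ τ : ℂ) = ℓ * τ := rfl

lemma coe_divPoint (n : ℤ) (τ : ℍ) : (divPoint ℓ n τ : ℂ) = (τ + n) / ℓ := rfl

lemma tendsto_mulPoint : Tendsto (mulPoint ℓ) atImInfty atImInfty := by
  rw [atImInfty, tendsto_comap_iff]
  have hlim : Tendsto (fun τ : ℍ ↦ (ℓ : ℝ) * τ.im) atImInfty atTop :=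
    tendsto_comap.const_mul_atTop (Nat.cast_pos.2 (NeZero.pos ℓ))
  refine hlim.congr fun τ ↦ ?_
  rw [Function.comp_apply, ← coe_im, ← coe_im, coe_mulPoint]
  simp

lemma tendsto_divPoint (n : ℤ) : Tendsto (divPoint ℓ n) atImInfty atImInfty := by
  rw [atImInfty, tendsto_comap_iff]
  have hlim : Tendsto (fun τ : ℍ ↦ τ.im / ℓ) atImInfty atTop :=
    tendsto_comap.atTop_div_const (Nat.cast_pos.2 (NeZero.pos ℓ))
  refine hlim.congr fun τ ↦ ?_
  rw [Function.comp_apply, ← coe_im, ← coe_im, coe_divPoint, Complex.div_natCast_im]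
  simp

lemma mulPoint_T_zpow_smul (n : ℤ) (τ : ℍ) :
    mulPoint ℓ (T ^ n • τ) = T ^ (ℓ * n : ℤ) • mulPoint ℓ τ := by
  ext
  simp only [coe_mulPoint, coe_T_zpow_smul]
  push_cast
  ring

lemma divPoint_T_zpow_smul (m n : ℤ) (τ : ℍ) :
    divPoint ℓ m (T ^ n • τ) = divPoint ℓ (m + n) τ := by
  ext
  simp only [coe_divPoint, coe_T_zpow_smul]
  push_cast
  ring

lemma divPoint_add_mul (m n : ℤ) (τ : ℍ) :
    divPoint ℓ (m + ℓ * n) τ = T ^ n • divPoint ℓ m τ := by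
  have hℓ : (ℓ : ℂ) ≠ 0 := NeZero.ne _
  ext
  simp only [coe_divPoint, coe_T_zpow_smul]
  push_cast
  field_simp
  ring

lemma mulPoint_S_smul (τ : ℍ) : mulPoint ℓ (S • τ) = S • divPoint ℓ 0 τ := by
  ext
  simp only [coe_mulPoint, coe_S_smul, coe_divPoint, Int.cast_zero, add_zero]
  field_simp

lemma divPoint_zero_S_smul (τ : ℍ) : divPoint ℓ 0 (S • τ) = S • mulPoint ℓ τ := by
  ext
  simp only [coe_mulPoint, coe_S_smul, coe_divPoint, Int.cast_zero, add_zero]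
  field_simp

lemma divPoint_mul_S_smul (n : ℤ) (τ : ℍ) :
    divPoint ℓ (ℓ * n) (S • τ) = (T ^ n * S) • mulPoint ℓ τ := by
  rw [← zero_add (ℓ * n : ℤ), divPoint_add_mul, divPoint_zero_S_smul, mul_smul]

lemma divPoint_S_smul {m n : ℤ} (hmn : (ℓ : ℤ) ∣ m * n + 1) :
    ∃ γ : SL(2, ℤ), γ 0 0 = m ∧ γ 1 0 = ℓ ∧ γ 1 1 = -n ∧
      ∀ τ, divPoint ℓ m (S • τ) = γ • divPoint ℓ n τ := by
  obtain ⟨b, hb⟩ := hmn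
  have hdet : (!![m, -b; ℓ, -n] : Matrix (Fin 2) (Fin 2) ℤ).det = 1 := by
    rw [Matrix.det_fin_two_of]
    linarith
  let γ : SL(2, ℤ) := ⟨!![m, -b; ℓ, -n], hdet⟩
  have hγ : (γ : Matrix (Fin 2) (Fin 2) ℤ) = !![m, -b; ℓ, -n] := rfl
  refine ⟨γ, rfl, rfl, rfl, fun τ ↦ ?_⟩
  have hℓ : (ℓ : ℂ) ≠ 0 := NeZero.ne _
  have hτ := ne_zero τ
  have hb' : (m * n + 1 : ℂ) = ℓ * b := mod_cast hb
  have hden : (ℓ : ℂ) * ((τ + n) / ℓ) + -n = τ := by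
    field_simp
    ring
  ext
  rw [coe_specialLinearGroup_apply, coe_divPoint, coe_divPoint, coe_S_smul]
  simp only [hγ, Matrix.of_apply, Matrix.cons_val', Matrix.cons_val_zero,
    Matrix.cons_val_fin_one, Matrix.cons_val_one, algebraMap_int_eq, eq_intCast, Int.cast_neg,
    Int.cast_natCast, Complex.ofReal_neg, Complex.ofReal_intCast, Complex.ofReal_natCast, hden]
  field_simp
  linear_combination -hb'

end IsogenousPoints

section Conjugates

lemma sq_eq_one_of_coprime {ℓ : ℕ} (hN : ℓ.Coprime 48) : (ℓ : ZMod 24) ^ 2 = 1 := by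
  have h24 : IsUnit (ℓ : ZMod 24) :=
    (ZMod.isUnit_iff_coprime ℓ 24).2 (hN.coprime_dvd_right (by norm_num))
  have hsq : ∀ u : (ZMod 24)ˣ, u ^ 2 = 1 := by decide
  simpa using congrArg Units.val (hsq h24.unit)

open ModularGroup
open scoped MatrixGroups Manifold

variable (ℓ : ℕ)

/-- The conjugates of `weberF (ℓ * τ)` over the field generated by `weberF τ`, indexed by the
projective line over `ZMod ℓ`. The shifts are by multiples of `48`, the width of the cusp `i∞`. -/
noncomputable def weberConj [NeZero ℓ] : Option (ZMod ℓ) → ℍ → ℂ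
  | none, τ => weberF (mulPoint ℓ τ)
  | some k, τ => weberF (divPoint ℓ (48 * k.val) τ)

section NeZero

variable [NeZero ℓ]

lemma weberConj_none (τ : ℍ) : weberConj ℓ none τ = weberF (mulPoint ℓ τ) := rfl

lemma weberConj_some (k : ZMod ℓ) (τ : ℍ) :
    weberConj ℓ (some k) τ = weberF (divPoint ℓ (48 * k.val) τ) := rfl

lemma weberConj_some_zero (τ : ℍ) : weberConj ℓ (some 0) τ = weberF (divPoint ℓ 0 τ) := by
  rw [weberConj_some, ZMod.val_zero, Nat.cast_zero, mul_zero]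

lemma weberConj_some_intCast (n : ℤ) (τ : ℍ) :
    weberConj ℓ (some n) τ = weberF (divPoint ℓ (48 * n) τ) := by
  obtain ⟨m, hm⟩ : (ℓ : ℤ) ∣ n - (n : ZMod ℓ).val := by
    rw [← ZMod.intCast_eq_intCast_iff_dvd_sub]
    simp
  have hn : 48 * n = 48 * ((n : ZMod ℓ).val : ℤ) + ℓ * (48 * m) := by linear_combination 48 * hm
  rw [weberConj_some, hn, divPoint_add_mul, coe_T_zpow_smul]
  exact_mod_cast (weberF_add_forty_eight_mul_intCast _ m).symm

lemma weberF_T_zpow_two_mul_smul (n : ℤ) (τ : ℍ) :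
    weberF (T ^ (2 * n) • τ : ℍ) = zeta24 ^ (-n) * weberF τ := by
  rw [coe_T_zpow_smul]
  exact_mod_cast weberF_add_two_mul_intCast τ n

variable {ℓ}

lemma exists_weberConj_T_sq (hN : ℓ.Coprime 48) :
    ∃ σ : Equiv.Perm (Option (ZMod ℓ)), ∀ i (τ : ℍ),
      weberConj ℓ i (T ^ 2 • τ) = zeta24 ^ (-ℓ : ℤ) * weberConj ℓ (σ i) τ := by
  obtain ⟨u, hu⟩ : ((24 : ℕ) : ℤ) ∣ ℓ ^ 2 - 1 := by
    rw [← ZMod.intCast_eq_intCast_iff_dvd_sub]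
    exact_mod_cast (sq_eq_one_of_coprime hN).symm
  refine ⟨Equiv.optionCongr (Equiv.addRight ((-u : ℤ) : ZMod ℓ)), fun i τ ↦ ?_⟩
  rw [← zpow_natCast]
  rcases i with _ | k
  · rw [weberConj_none, mulPoint_T_zpow_smul, mul_comm, Nat.cast_two, weberF_T_zpow_two_mul_smul]
    rfl
  · have hk : Equiv.optionCongr (Equiv.addRight ((-u : ℤ) : ZMod ℓ)) (some k) =
        some ((k.val + -u : ℤ) : ZMod ℓ) := by simp
    have hshift : 48 * (k.val : ℤ) + (2 : ℕ) = 48 * (k.val + -u) + ℓ * (2 * ℓ) := by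
      push_cast
      linear_combination -2 * hu
    rw [hk, weberConj_some_intCast, weberConj_some, divPoint_T_zpow_smul, hshift, divPoint_add_mul,
      weberF_T_zpow_two_mul_smul]

lemma evalEval_weberConj_eq_zero {P : ℂ[X][X]} (hP : P ∈ weberRelations ℓ)
    (i : Option (ZMod ℓ)) (τ : ℍ) : P.evalEval (weberF τ) (weberConj ℓ i τ) = 0 := by
  rw [mem_weberRelations] at hP
  have hzero (τ : ℍ) : P.evalEval (weberF τ) (weberConj ℓ (some 0) τ) = 0 := by
    have h := hP (S • τ)
    rwa [← coe_mulPoint, mulPoint_S_smul, weberF_S_smul, weberF_S_smul,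
      ← weberConj_some_zero] at h
  rcases i with _ | k
  · exact hP τ
  · have h := hzero (T ^ (48 * k.val : ℤ) • τ)
    rw [weberConj_some_zero, divPoint_T_zpow_smul, zero_add, ← weberConj_some,
      coe_T_zpow_smul] at h
    have hperiod := weberF_add_forty_eight_mul_intCast τ k.val
    push_cast at h hperiod
    rwa [hperiod] at h

end NeZero

/-- The involution of the conjugates induced by `S`, which is `x ↦ -(48² * x)⁻¹` on the projective
line. -/
def conjInv : Option (ZMod ℓ) → Option (ZMod ℓ)
  | none => some 0
  | some k => if k = 0 then none else some (-(48 ^ 2 * k)⁻¹)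

section Prime

variable [Fact ℓ.Prime]

variable {ℓ}

lemma forty_eight_ne_zero (hN : ℓ.Coprime 48) : (48 : ZMod ℓ) ≠ 0 := by
  exact_mod_cast ((ZMod.isUnit_iff_coprime 48 ℓ).2 hN.symm).ne_zero

lemma conjInv_involutive (hN : ℓ.Coprime 48) : Function.Involutive (conjInv ℓ) := by
  have h48 := forty_eight_ne_zero hN
  rintro (_ | k)
  · simp [conjInv]
  · by_cases hk : k = 0
    · simp [conjInv, hk]
    · simp only [conjInv, hk, if_false]
      rw [if_neg (by simp [hk, h48])]
      congr 1
      field_simp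

lemma weberConj_S (hN : ℓ.Coprime 48) (i : Option (ZMod ℓ)) (τ : ℍ) :
    weberConj ℓ i (S • τ) = weberConj ℓ (conjInv ℓ i) τ := by
  rcases i with _ | k
  · rw [weberConj_none, mulPoint_S_smul, weberF_S_smul, conjInv, weberConj_some_zero]
  by_cases hk : k = 0
  · rw [hk, weberConj_some_zero, divPoint_zero_S_smul, weberF_S_smul, conjInv, if_pos rfl,
      weberConj_none]
  · have h48 := forty_eight_ne_zero hN
    rw [conjInv, if_neg hk]
    set k' : ZMod ℓ := -(48 ^ 2 * k)⁻¹ with hk'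
    have hdvd : (ℓ : ℤ) ∣ (48 * k.val) * (48 * k'.val) + 1 := by
      rw [← ZMod.intCast_zmod_eq_zero_iff_dvd]
      push_cast
      rw [ZMod.natCast_zmod_val, ZMod.natCast_zmod_val, hk']
      field_simp
      ring
    obtain ⟨γ, ha, -, hd, hγ⟩ := divPoint_S_smul ℓ hdvd
    rw [weberConj_some, weberConj_some, hγ]
    exact weberF_smul_of_dvd (by simp [ha]) (by simp [hd]) _

end Prime

end Conjugates

section RegularConjugates

open ModularGroup
open scoped MatrixGroups Manifold

lemma isBoundedAtImInfty_weberF_smul_comp {γ : SL(2, ℤ)} {p : ℍ → ℍ}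
    (hγ : Even (γ 0 0 + γ 1 0)) (hp : Tendsto p atImInfty atImInfty) :
    IsBoundedAtImInfty fun τ ↦ weberF (γ • p τ : ℍ) := by
  obtain ⟨e, he⟩ := exists_weberF_smul_of_even hγ
  have hbdd : (fun τ ↦ weberF ((T * S) • p τ : ℍ)) =O[atImInfty] (1 : ℍ → ℝ) :=
    IsRegularAwayFromInfty.weberF.bounded.comp_tendsto hp
  exact (hbdd.const_mul_left (zeta24 ^ e)).congr_left fun τ ↦ (he (p τ)).symm

lemma even_T_zpow_mul_S {n : ℤ} (hn : Odd n) :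
    Even ((T ^ n * S : SL(2, ℤ)) 0 0 + (T ^ n * S : SL(2, ℤ)) 1 0) := by
  simpa [coe_T_zpow, coe_S] using hn.add_one

variable (ℓ : ℕ)

section NeZero

variable [NeZero ℓ]

lemma mdifferentiable_weberConj (i : Option (ZMod ℓ)) :
    MDifferentiable 𝓘(ℂ) 𝓘(ℂ) (weberConj ℓ i) := by
  rcases i with _ | k
  · exact mdifferentiable_weberF_comp (g := fun z ↦ ℓ * z) (by fun_prop)
      fun z hz ↦ (mulPoint ℓ ⟨z, hz⟩).im_pos
  · exact mdifferentiable_weberF_comp (g := fun z ↦ (z + (48 * k.val : ℤ)) / ℓ) (by fun_prop)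
      fun z hz ↦ (divPoint ℓ (48 * k.val) ⟨z, hz⟩).im_pos

lemma tendsto_weberConj_none_mul_cuspParam_pow :
    Tendsto (fun τ : ℍ ↦ weberConj ℓ none τ * cuspParam τ ^ ℓ) atImInfty (𝓝 1) := by
  refine (tendsto_weberF_mul_cuspParam.comp (tendsto_mulPoint ℓ)).congr fun τ ↦ ?_
  rw [Function.comp_apply, coe_mulPoint, cuspParam_natCast_mul, weberConj_none, coe_mulPoint]

lemma cuspParam_divPoint (n : ℤ) (τ : ℍ) :
    cuspParam (divPoint ℓ (48 * n) τ) = cexp (2 * Real.pi * Complex.I / ℓ) ^ n *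
      cuspParam (divPoint ℓ 0 τ) := by
  rw [← Complex.exp_int_mul, cuspParam_def, cuspParam_def, ← Complex.exp_add, coe_divPoint,
    coe_divPoint]
  congr 1
  push_cast
  field_simp
  ring

lemma cuspParam_divPoint_zero_pow (τ : ℍ) : cuspParam (divPoint ℓ 0 τ) ^ ℓ = cuspParam τ := by
  rw [← cuspParam_natCast_mul, coe_divPoint, mul_div_cancel₀ _ (NeZero.ne (ℓ : ℂ)), Int.cast_zero,
    add_zero]

lemma tendsto_cuspParam_divPoint (n : ℤ) :
    Tendsto (fun τ ↦ cuspParam (divPoint ℓ n τ)) atImInfty (𝓝 0) :=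
  tendsto_cuspParam.comp (tendsto_divPoint ℓ n)

lemma tendsto_weberConj_some_mul (k : ZMod ℓ) :
    Tendsto (fun τ ↦ weberConj ℓ (some k) τ * cuspParam (divPoint ℓ 0 τ)) atImInfty
      (𝓝 (cexp (2 * Real.pi * Complex.I / ℓ) ^ k.val)⁻¹) := by
  have hlim := (tendsto_weberF_mul_cuspParam.comp (tendsto_divPoint ℓ (48 * k.val))).mul_const
    (cexp (2 * Real.pi * Complex.I / ℓ) ^ k.val)⁻¹
  rw [one_mul] at hlim
  refine hlim.congr fun τ ↦ ?_
  rw [Function.comp_apply, cuspParam_divPoint, weberConj_some, zpow_natCast]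
  field_simp [exp_ne_zero]

variable {ℓ}

lemma tendsto_weberConj_some_mul_cuspParam_pow (hℓ : 1 < ℓ) (k : ZMod ℓ) :
    Tendsto (fun τ ↦ weberConj ℓ (some k) τ * cuspParam τ ^ ℓ) atImInfty (𝓝 0) := by
  have hsq : 1 < ℓ ^ 2 := Nat.one_lt_pow two_ne_zero hℓ
  have hlim := (tendsto_weberConj_some_mul ℓ k).mul
    ((tendsto_cuspParam_divPoint ℓ 0).pow (ℓ ^ 2 - 1))
  rw [zero_pow (by omega), mul_zero] at hlim
  refine hlim.congr fun τ ↦ ?_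
  rw [mul_assoc, mul_pow_sub_one (by omega), sq, pow_mul, cuspParam_divPoint_zero_pow]

lemma isBoundedAtImInfty_weberConj_mul_cuspParam_pow (hℓ : 1 < ℓ) (i : Option (ZMod ℓ)) :
    IsBoundedAtImInfty fun τ ↦ weberConj ℓ i τ * cuspParam τ ^ ℓ := by
  rcases i with _ | k
  · exact (tendsto_weberConj_none_mul_cuspParam_pow ℓ).isBigO_one ℝ
  · exact (tendsto_weberConj_some_mul_cuspParam_pow hℓ k).isBigO_one ℝ

end NeZero

variable {ℓ} [Fact ℓ.Prime]

lemma isBoundedAtImInfty_weberF_divPoint_S_smul (hℓ : Odd (ℓ : ℤ)) {n : ℤ} (hn : Odd n) :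
    IsBoundedAtImInfty fun τ ↦ weberF (divPoint ℓ n (S • τ)) := by
  by_cases hdvd : (ℓ : ℤ) ∣ n
  · obtain ⟨u, rfl⟩ := hdvd
    simpa only [divPoint_mul_S_smul] using
      isBoundedAtImInfty_weberF_smul_comp (even_T_zpow_mul_S (Int.odd_mul.1 hn).2)
        (tendsto_mulPoint ℓ)
  · have hn0 : (n : ZMod ℓ) ≠ 0 := by rwa [Ne, ZMod.intCast_zmod_eq_zero_iff_dvd]
    obtain ⟨γ, ha, hc, -, hγ⟩ : ∃ γ : SL(2, ℤ), γ 0 0 = n ∧ γ 1 0 = ℓ ∧ γ 1 1 = _ ∧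
        ∀ τ, divPoint ℓ n (S • τ) = γ • divPoint ℓ (-(n : ZMod ℓ)⁻¹).val τ := by
      refine divPoint_S_smul ℓ ?_
      rw [← ZMod.intCast_zmod_eq_zero_iff_dvd]
      push_cast
      rw [ZMod.natCast_zmod_val, mul_neg, mul_inv_cancel₀ hn0, neg_add_cancel]
    simpa only [hγ] using isBoundedAtImInfty_weberF_smul_comp (by rw [ha, hc]; exact hn.add_odd hℓ)
      (tendsto_divPoint ℓ _)

lemma isBoundedAtImInfty_weberConj_T_mul_S_smul (hℓ : Odd (ℓ : ℤ)) (i : Option (ZMod ℓ)) :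
    IsBoundedAtImInfty fun τ ↦ weberConj ℓ i ((T * S) • τ) := by
  rcases i with _ | k
  · have hmul (τ : ℍ) : mulPoint ℓ ((T * S) • τ) = (T ^ (ℓ : ℤ) * S) • divPoint ℓ 0 τ := by
      have hT := mulPoint_T_zpow_smul ℓ 1 (S • τ)
      rwa [zpow_one, mul_one, mulPoint_S_smul, ← mul_smul, ← mul_smul] at hT
    simpa only [weberConj_none, hmul] using
      isBoundedAtImInfty_weberF_smul_comp (even_T_zpow_mul_S hℓ) (tendsto_divPoint ℓ 0)
  · have hdiv (τ : ℍ) :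
        divPoint ℓ (48 * k.val) ((T * S) • τ) = divPoint ℓ (48 * k.val + 1) (S • τ) := by
      rw [mul_smul, ← divPoint_T_zpow_smul, zpow_one]
    simpa only [weberConj_some, hdiv] using
      isBoundedAtImInfty_weberF_divPoint_S_smul hℓ ⟨24 * k.val, by ring⟩

lemma isRegularAwayFromInfty_weberConj (hN : ℓ.Coprime 48) (i : Option (ZMod ℓ)) :
    IsRegularAwayFromInfty (weberConj ℓ i) where
  mdifferentiable := mdifferentiable_weberConj ℓ i
  growth := ⟨ℓ, isBoundedAtImInfty_weberConj_mul_cuspParam_pow (Fact.out : ℓ.Prime).one_lt i⟩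
  bounded := isBoundedAtImInfty_weberConj_T_mul_S_smul
    (mod_cast Nat.coprime_two_right.1 (hN.coprime_dvd_right (by norm_num))) i

end RegularConjugates

section ConjugatePolynomial

open ModularGroup

lemma prod_X_sub_C_scaleRoots {R ι : Type*} [CommRing R] [NoZeroDivisors R] (s : Finset ι)
    (a : ι → R) (r : R) :
    (∏ i ∈ s, (X - C (a i))).scaleRoots r = ∏ i ∈ s, (X - C (r * a i)) := by
  classical
  induction s using Finset.induction_on with
  | empty => simp [one_scaleRoots]
  | insert i s hi ih =>
    rw [Finset.prod_insert hi, Finset.prod_insert hi, mul_scaleRoots_of_noZeroDivisors, ih,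
      X_sub_C_scaleRoots, mul_comm (a i)]

/-- The polynomial over the ring of functions on the upper half-plane whose roots are the
conjugates of `weberF (ℓ * τ)`. -/
noncomputable def conjPoly (ℓ : ℕ) [NeZero ℓ] : (ℍ → ℂ)[X] :=
  ∏ i : Option (ZMod ℓ), (X - C (weberConj ℓ i))

lemma monic_conjPoly (ℓ : ℕ) [NeZero ℓ] : (conjPoly ℓ).Monic :=
  monic_prod_of_monic _ _ fun _ _ ↦ monic_X_sub_C _

lemma natDegree_conjPoly (ℓ : ℕ) [NeZero ℓ] : (conjPoly ℓ).natDegree = ℓ + 1 := by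
  rw [conjPoly, natDegree_finsetProd_X_sub_C_eq_card]
  simp

lemma map_evalRingHom_conjPoly (ℓ : ℕ) [NeZero ℓ] (τ : ℍ) :
    (conjPoly ℓ).map (Pi.evalRingHom (fun _ ↦ ℂ) τ) =
      ∏ i : Option (ZMod ℓ), (X - C (weberConj ℓ i τ)) := by
  simp [conjPoly, Polynomial.map_prod]

variable {ℓ : ℕ} [Fact ℓ.Prime]

lemma isRegularAwayFromInfty_coeff_conjPoly (hN : ℓ.Coprime 48) (j : ℕ) :
    IsRegularAwayFromInfty ((conjPoly ℓ).coeff j) := by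
  have hlifts : conjPoly ℓ ∈ lifts (regularSubalgebra.val : regularSubalgebra →+* (ℍ → ℂ)) := by
    refine Subsemiring.prod_mem _ fun i _ ↦ ?_
    exact ⟨X - C ⟨weberConj ℓ i, isRegularAwayFromInfty_weberConj hN i⟩, by simp⟩
  obtain ⟨G, hG⟩ := (lifts_iff_coeff_lifts _).1 hlifts j
  exact hG ▸ G.2

lemma map_evalRingHom_conjPoly_S (hN : ℓ.Coprime 48) (τ : ℍ) :
    (conjPoly ℓ).map (Pi.evalRingHom (fun _ ↦ ℂ) (S • τ)) =
      (conjPoly ℓ).map (Pi.evalRingHom (fun _ ↦ ℂ) τ) := by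
  simp only [map_evalRingHom_conjPoly, weberConj_S hN]
  exact Equiv.prod_comp (conjInv_involutive hN).toPerm fun i ↦ X - C (weberConj ℓ i τ)

lemma map_evalRingHom_conjPoly_T_sq (hN : ℓ.Coprime 48) (τ : ℍ) :
    (conjPoly ℓ).map (Pi.evalRingHom (fun _ ↦ ℂ) (T ^ 2 • τ)) =
      ((conjPoly ℓ).map (Pi.evalRingHom (fun _ ↦ ℂ) τ)).scaleRoots (zeta24 ^ (-ℓ : ℤ)) := by
  obtain ⟨σ, hσ⟩ := exists_weberConj_T_sq hN
  simp only [map_evalRingHom_conjPoly, hσ, prod_X_sub_C_scaleRoots]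
  exact Equiv.prod_comp σ fun i ↦ X - C (zeta24 ^ (-ℓ : ℤ) * weberConj ℓ i τ)

lemma hasThetaCharacter_coeff_conjPoly (hN : ℓ.Coprime 48) (j : ℕ) :
    HasThetaCharacter ((conjPoly ℓ).coeff j) ((zeta24 ^ (-ℓ : ℤ)) ^ (ℓ + 1 - j)) where
  pow_eq_one := by
    have h24 : (zeta24 ^ (-ℓ : ℤ)) ^ 24 = 1 := by
      rw [← zpow_natCast, zpow_comm, zpow_natCast, isPrimitiveRoot_zeta24.pow_eq_one, one_zpow]
    rw [← pow_mul, mul_comm, pow_mul, h24, one_pow]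
  smul_S τ := by
    simpa only [coeff_map, Pi.evalRingHom_apply] using
      congrArg (coeff · j) (map_evalRingHom_conjPoly_S hN τ)
  smul_T_sq τ := by
    have h := congrArg (coeff · j) (map_evalRingHom_conjPoly_T_sq hN τ)
    simpa only [coeff_scaleRoots, (monic_conjPoly ℓ).natDegree_map, natDegree_conjPoly, coeff_map,
      Pi.evalRingHom_apply, mul_comm] using h

lemma exists_map_aeval_eq_conjPoly (hN : ℓ.Coprime 48) :
    ∃ P : ℂ[X][X], P.Monic ∧ P.natDegree = ℓ + 1 ∧
      P.map (aeval fun τ : ℍ ↦ weberF τ : ℂ[X] →ₐ[ℂ] ℍ → ℂ).toRingHom = conjPoly ℓ := by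
  have hlifts : conjPoly ℓ ∈
      lifts (aeval fun τ : ℍ ↦ weberF τ : ℂ[X] →ₐ[ℂ] ℍ → ℂ).toRingHom := by
    refine (lifts_iff_coeff_lifts _).2 fun j ↦ ?_
    obtain ⟨p, hp⟩ := exists_eq_eval_weberF (isRegularAwayFromInfty_coeff_conjPoly hN j)
      (hasThetaCharacter_coeff_conjPoly hN j)
    refine ⟨p, funext fun τ ↦ ?_⟩
    rw [hp]
    exact (aeval_fn_apply _ _ _).trans (congrFun (coe_aeval_eq_eval _) p)
  obtain ⟨P, hmap, hdeg, hmonic⟩ := lifts_and_natDegree_eq_and_monic hlifts (monic_conjPoly ℓ)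
  exact ⟨P, hmonic, hdeg.trans (natDegree_conjPoly ℓ), hmap⟩

theorem exists_monic_mem_weberRelations (hN : ℓ.Coprime 48) :
    ∃ P ∈ weberRelations ℓ, P.Monic ∧ P.natDegree = ℓ + 1 := by
  obtain ⟨P, hmonic, hdeg, hmap⟩ := exists_map_aeval_eq_conjPoly hN
  refine ⟨P, mem_weberRelations.2 fun τ ↦ ?_, hmonic, hdeg⟩
  have hτ : P.map (evalRingHom (weberF τ)) =
      ∏ i : Option (ZMod ℓ), (X - C (weberConj ℓ i τ)) := by
    rw [← map_evalRingHom_conjPoly, ← hmap, Polynomial.map_map]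
    congr 1
    ext <;> simp
  rw [← map_evalRingHom_eval, hτ, eval_prod]
  exact Finset.prod_eq_zero (Finset.mem_univ none) (by simp [weberConj_none, coe_mulPoint])

end ConjugatePolynomial

section Uniqueness

lemma eventually_ne_of_tendsto {α E : Type*} [TopologicalSpace E] [T2Space E] {l : Filter α}
    {f g : α → E} {a b : E} (hf : Tendsto f l (𝓝 a)) (hg : Tendsto g l (𝓝 b)) (hab : a ≠ b) :
    ∀ᶠ x in l, f x ≠ g x :=
  (hf.prodMk_nhds hg).eventually (isOpen_ne_fun continuous_fst continuous_snd |>.mem_nhds hab)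

lemma tendsto_weberF_cobounded :
    Tendsto (fun τ : ℍ ↦ weberF τ) atImInfty (Bornology.cobounded ℂ) := by
  rw [← tendsto_norm_atTop_iff_cobounded]
  have hinv : Tendsto (fun τ : ℍ ↦ ‖cuspParam τ‖⁻¹) atImInfty atTop :=
    tendsto_inv_nhdsGT_zero.comp (tendsto_nhdsWithin_iff.2
      ⟨tendsto_zero_iff_norm_tendsto_zero.1 tendsto_cuspParam,
        .of_forall fun τ ↦ norm_pos_iff.2 (cuspParam_ne_zero τ)⟩)
  refine (tendsto_weberF_mul_cuspParam.norm.pos_mul_atTop (by simp) hinv).congr fun τ ↦ ?_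
  rw [norm_mul, mul_inv_cancel_right₀ (norm_ne_zero_iff.2 (cuspParam_ne_zero τ))]

lemma eq_zero_of_eventually_eval_weberF {p : ℂ[X]}
    (hp : ∀ᶠ τ : ℍ in atImInfty, p.eval (weberF τ) = 0) : p = 0 := by
  by_contra hne
  have hfin : {x | p.IsRoot x}.Finite := finite_setOfPred_isRoot hne
  obtain ⟨τ, hτ, hτ'⟩ :=
    (hp.and (tendsto_weberF_cobounded.eventually (Bornology.isBounded_def.1 hfin.isBounded))).exists
  exact hτ' hτ

variable {ℓ : ℕ} [NeZero ℓ]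

lemma eventually_weberConj_none_ne (hℓ : 1 < ℓ) (k : ZMod ℓ) :
    ∀ᶠ τ in atImInfty, weberConj ℓ none τ ≠ weberConj ℓ (some k) τ := by
  filter_upwards [eventually_ne_of_tendsto (tendsto_weberConj_none_mul_cuspParam_pow ℓ)
    (tendsto_weberConj_some_mul_cuspParam_pow hℓ k) one_ne_zero] with τ hτ hτ'
  exact hτ (by rw [hτ'])

lemma eventually_weberConj_some_ne {j k : ZMod ℓ} (hjk : j ≠ k) :
    ∀ᶠ τ in atImInfty, weberConj ℓ (some j) τ ≠ weberConj ℓ (some k) τ := by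
  have hζ := Complex.isPrimitiveRoot_exp ℓ (NeZero.ne ℓ)
  have hne : (cexp (2 * Real.pi * Complex.I / ℓ) ^ j.val)⁻¹ ≠
      (cexp (2 * Real.pi * Complex.I / ℓ) ^ k.val)⁻¹ := fun h ↦
    hjk (ZMod.val_injective ℓ (hζ.pow_inj (ZMod.val_lt j) (ZMod.val_lt k) (inv_injective h)))
  filter_upwards [eventually_ne_of_tendsto (tendsto_weberConj_some_mul ℓ j)
    (tendsto_weberConj_some_mul ℓ k) hne] with τ hτ hτ'
  exact hτ (by rw [hτ'])

lemma eventually_injective_weberConj (hℓ : 1 < ℓ) :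
    ∀ᶠ τ in atImInfty, Function.Injective fun i ↦ weberConj ℓ i τ := by
  have hne : ∀ᶠ τ in atImInfty, ∀ i j, i ≠ j → weberConj ℓ i τ ≠ weberConj ℓ j τ := by
    refine eventually_all.2 fun i ↦ eventually_all.2 fun j ↦
      eventually_imp_distrib_left.2 fun hij ↦ ?_
    rcases i with _ | i <;> rcases j with _ | j
    · exact (hij rfl).elim
    · exact eventually_weberConj_none_ne hℓ j
    · exact (eventually_weberConj_none_ne hℓ i).mono fun _ ↦ Ne.symm
    · exact eventually_weberConj_some_ne fun h ↦ hij (congrArg some h)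
  filter_upwards [hne] with τ hτ i j hij
  by_contra h
  exact hτ i j h hij

theorem eq_zero_of_mem_weberRelations_of_natDegree_le (hℓ : 1 < ℓ) {P : ℂ[X][X]}
    (hP : P ∈ weberRelations ℓ) (hdeg : P.natDegree ≤ ℓ) : P = 0 := by
  ext1 j
  refine eq_zero_of_eventually_eval_weberF ?_
  filter_upwards [eventually_injective_weberConj hℓ] with τ hτ
  have hmap : P.map (evalRingHom (weberF τ)) = 0 := by
    refine eq_zero_of_natDegree_lt_card_of_eval_eq_zero _ hτ (fun i ↦ ?_) ?_
    · rw [map_evalRingHom_eval, evalEval_weberConj_eq_zero hP]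
    · exact natDegree_map_le.trans_lt (hdeg.trans_lt (by simp))
  simpa using congrArg (coeff · j) hmap

lemma dvd_of_mem_weberRelations (hℓ : 1 < ℓ) {P Q : ℂ[X][X]} (hmonic : Q.Monic)
    (hdeg : Q.natDegree = ℓ + 1) (hQ : Q ∈ weberRelations ℓ) (hP : P ∈ weberRelations ℓ) :
    Q ∣ P := by
  rw [← modByMonic_eq_zero_iff_dvd hmonic]
  refine eq_zero_of_mem_weberRelations_of_natDegree_le hℓ ?_ ?_
  · rw [modByMonic_eq_sub_mul_div]
    exact sub_mem hP (Ideal.mul_mem_right _ _ hQ)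
  · have := natDegree_modByMonic_lt P hmonic (by rintro rfl; simp at hdeg)
    omega

end Uniqueness

section RelationIdeal

open scoped Manifold

lemma mdifferentiable_evalEval {f g : ℍ → ℂ} (hf : MDifferentiable 𝓘(ℂ) 𝓘(ℂ) f)
    (hg : MDifferentiable 𝓘(ℂ) 𝓘(ℂ) g) (P : ℂ[X][X]) :
    MDifferentiable 𝓘(ℂ) 𝓘(ℂ) fun τ ↦ P.evalEval (f τ) (g τ) := by
  obtain ⟨A, hA⟩ := exists_natDegree_coeff_lt P
  simp only [evalEval_eq_sum P.natDegree.lt_succ_self hA]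
  rw [mdifferentiable_iff] at hf hg ⊢
  exact .fun_sum fun p _ ↦ ((hf.pow p.1).mul (hg.pow p.2)).const_mul _

lemma isPrime_weberRelations (ℓ : ℕ) [NeZero ℓ] : (weberRelations ℓ).IsPrime := by
  have hdiff := mdifferentiable_evalEval mdifferentiable_weberF (mdifferentiable_weberConj ℓ none)
  refine ⟨(Ideal.ne_top_iff_one _).2 fun h ↦ ?_, fun {P Q} hPQ ↦ ?_⟩
  · simpa using mem_weberRelations.1 h I
  · simp only [mem_weberRelations] at hPQ ⊢
    have hzero := (mul_eq_zero_iff (hdiff P) (hdiff Q)).1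
      (funext fun τ ↦ (evalEval_mul _ _ P Q).symm.trans (hPQ τ))
    exact hzero.imp congrFun congrFun

end RelationIdeal

section Twist

open ModularGroup

section CommSemiring

variable {R : Type*} [CommSemiring R]

/-- The polynomial `P(a * x, b * y)`, where `x` is the inner and `y` the outer variable. -/
noncomputable def twist (a b : R) (P : R[X][X]) : R[X][X] :=
  (P.map (compRingHom (C a * X))).comp (C (C b) * X)

lemma coeff_twist (a b : R) (P : R[X][X]) (j : ℕ) :
    (twist a b P).coeff j = (P.coeff j).comp (C a * X) * C (b ^ j) := by
  simp [twist, comp_C_mul_X_coeff]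

lemma coeff_coeff_twist (a b : R) (P : R[X][X]) (i j : ℕ) :
    ((twist a b P).coeff j).coeff i = a ^ i * b ^ j * (P.coeff j).coeff i := by
  rw [coeff_twist, coeff_mul_C, comp_C_mul_X_coeff]
  ring

lemma evalEval_twist (a b x y : R) (P : R[X][X]) :
    (twist a b P).evalEval x y = P.evalEval (a * x) (b * y) := by
  have hx : (evalRingHom x).comp (compRingHom (C a * X)) = evalRingHom (a * x) := by
    ext <;> simp
  rw [← map_evalRingHom_eval, ← map_evalRingHom_eval, twist, Polynomial.map_comp, eval_comp,
    Polynomial.map_map, hx]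
  simp

end CommSemiring

lemma twist_mem_weberRelations {ℓ : ℕ} {P : ℂ[X][X]} (hP : P ∈ weberRelations ℓ) :
    twist zeta24⁻¹ (zeta24⁻¹ ^ ℓ) P ∈ weberRelations ℓ := by
  rw [mem_weberRelations] at hP ⊢
  intro τ
  have hmul : weberF (ℓ * (T ^ 2 • τ : ℍ)) = zeta24⁻¹ ^ ℓ * weberF (ℓ * τ) := by
    rw [inv_pow, ← zpow_natCast zeta24, ← zpow_neg, ← weberF_add_two_mul_intCast, coe_T_sq_smul]
    push_cast
    ring_nf
  rw [evalEval_twist, ← weberF_T_sq_smul, ← hmul]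
  exact hP _

lemma twist_eq_C_C_mul {ℓ : ℕ} [NeZero ℓ] (hℓ : 1 < ℓ) {P : ℂ[X][X]} (hP : P ∈ weberRelations ℓ)
    (hmonic : P.Monic) (hdeg : P.natDegree = ℓ + 1) :
    twist zeta24⁻¹ (zeta24⁻¹ ^ ℓ) P = C (C (zeta24⁻¹ ^ (ℓ * (ℓ + 1)))) * P := by
  rw [← sub_eq_zero]
  refine eq_zero_of_mem_weberRelations_of_natDegree_le hℓ
    (sub_mem (twist_mem_weberRelations hP) (Ideal.mul_mem_left _ _ hP))
    (natDegree_le_iff_coeff_eq_zero.2 fun j hj ↦ ?_)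
  rw [coeff_sub, coeff_twist, coeff_C_mul]
  rcases (Nat.succ_le_of_lt hj).eq_or_lt with rfl | hj
  · have hlead : P.coeff (ℓ + 1) = 1 := hdeg ▸ hmonic
    simp [hlead, pow_mul]
  · simp [coeff_eq_zero_of_natDegree_lt (hdeg.trans_lt hj)]

theorem modEq_of_mem_weberRelations_of_monic {ℓ : ℕ} (hℓ : 1 < ℓ) (hN : ℓ.Coprime 48) {P : ℂ[X][X]}
    (hP : P ∈ weberRelations ℓ) (hmonic : P.Monic) (hdeg : P.natDegree = ℓ + 1) {i j : ℕ}
    (hij : (P.coeff j).coeff i ≠ 0) : i + ℓ * j ≡ ℓ + 1 [MOD 24] := by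
  have : NeZero ℓ := ⟨by omega⟩
  have htwist := congrArg (fun Q : ℂ[X][X] ↦ (Q.coeff j).coeff i)
    (twist_eq_C_C_mul hℓ hP hmonic hdeg)
  simp only [coeff_coeff_twist, coeff_C_mul] at htwist
  have hpow := mul_right_cancel₀ hij htwist
  rw [← pow_mul, ← pow_add, isPrimitiveRoot_zeta24.inv.isOfFinOrder (by norm_num)
    |>.pow_eq_pow_iff_modEq, ← isPrimitiveRoot_zeta24.inv.eq_orderOf] at hpow
  refine hpow.trans ((ZMod.natCast_eq_natCast_iff _ _ _).1 ?_)
  push_cast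
  linear_combination sq_eq_one_of_coprime hN

end Twist

section IntegralPolynomials

section FractionRing

variable (A : Type*) {K : Type*} [CommRing A] [Field K] [Algebra A K] [IsFractionRing A K]

attribute [local instance] Polynomial.algebra in
lemma exists_map_eq_C_C_mul [IsDomain A] (P : K[X][X]) : ∃ a : A, a ≠ 0 ∧ ∃ Q : A[X][X],
    Q.map (mapRingHom (algebraMap A K)) = C (C (algebraMap A K a)) * P := by
  have := isLocalization (nonZeroDivisors A) K
  have := isLocalization ((nonZeroDivisors A).map C) K[X]
  obtain ⟨⟨Q, _, _, ⟨a, ha, rfl⟩, rfl⟩, hQ⟩ :=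
    IsLocalization.surj (((nonZeroDivisors A).map C).map C) P
  exact ⟨a, nonZeroDivisors.ne_zero ha, Q, by simpa [mul_comm] using hQ.symm⟩

end FractionRing

lemma exists_eq_C_C_of_dvd {A : Type*} [CommRing A] [IsDomain A] {F : A[X][X]} {a : A} (ha : a ≠ 0)
    (hF : F ∣ C (C a)) : ∃ c, F = C (C c) := by
  have hFy := natDegree_le_of_dvd hF (by simpa using ha)
  rw [natDegree_C, Nat.le_zero] at hFy
  obtain ⟨f, rfl⟩ := natDegree_eq_zero.1 hFy
  have hf : f ∣ C a := by simpa using (C_dvd_iff_dvd_coeff _ _).1 hF 0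
  have hfx := natDegree_le_of_dvd hf (by simpa using ha)
  rw [natDegree_C, Nat.le_zero] at hfx
  obtain ⟨c, rfl⟩ := natDegree_eq_zero.1 hfx
  exact ⟨c, rfl⟩

lemma exists_eq_C_C_mul_of_prime {A : Type*} [CommRing A] [IsDomain A] {P Q B : A[X][X]} {a : A}
    (hP : Prime P) (ha : a ≠ 0) (hQ : Q.natDegree ≠ 0) (h : C (C a) * P = Q * B) :
    ∃ c, Q = C (C c) * P := by
  rcases hP.dvd_or_dvd (h ▸ dvd_mul_left P _) with ⟨F, rfl⟩ | ⟨E, rfl⟩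
  · obtain ⟨c, rfl⟩ := exists_eq_C_C_of_dvd (F := F) ha
      ⟨B, mul_left_cancel₀ hP.ne_zero (by rw [mul_comm, h, mul_assoc])⟩
    exact ⟨c, mul_comm _ _⟩
  · obtain ⟨c, rfl⟩ := exists_eq_C_C_of_dvd ha
      ⟨E, mul_left_cancel₀ hP.ne_zero (by rw [mul_comm, h, mul_left_comm])⟩
    exact (hQ (natDegree_C _)).elim

theorem exists_eq_C_C_mul_map_of_irreducible {A K : Type*} [CommRing A] [IsDomain A]
    [UniqueFactorizationMonoid A] [Field K] [Algebra A K] [IsFractionRing A K] {P : A[X][X]}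
    (hP : Irreducible P) {Q : K[X][X]} (hQ : Q.natDegree ≠ 0)
    (hdvd : Q ∣ P.map (mapRingHom (algebraMap A K))) :
    ∃ c : K, Q = C (C c) * P.map (mapRingHom (algebraMap A K)) := by
  have hinj : Function.Injective (mapRingHom (algebraMap A K)) :=
    map_injective _ (IsFractionRing.injective A K)
  obtain ⟨B, hB⟩ := hdvd
  obtain ⟨q, hq, Q', hQ'⟩ := exists_map_eq_C_C_mul A Q
  obtain ⟨b, hb, B', hB'⟩ := exists_map_eq_C_C_mul A B
  have hq' : algebraMap A K q ≠ 0 := by simpa using hq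
  have hmul : C (C (q * b)) * P = Q' * B' := by
    apply map_injective _ hinj
    simp only [Polynomial.map_mul, map_C, coe_mapRingHom, hB, hQ', hB', map_mul]
    ring
  have hdeg : Q'.natDegree ≠ 0 := by
    rwa [← natDegree_map_eq_of_injective hinj, hQ', natDegree_C_mul (by simpa using hq)]
  obtain ⟨c, rfl⟩ := exists_eq_C_C_mul_of_prime hP.prime (mul_ne_zero hq hb) hdeg hmul
  refine ⟨(algebraMap A K q)⁻¹ * algebraMap A K c, ?_⟩
  calc
    Q = C (C (algebraMap A K q)⁻¹) * (C (C (algebraMap A K q)) * Q) := by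
      rw [← mul_assoc, ← C_mul, ← C_mul, inv_mul_cancel₀ hq', C_1, C_1, one_mul]
    _ = _ := by
      rw [← hQ', Polynomial.map_mul, map_C, coe_mapRingHom, map_C, C_mul, C_mul, mul_assoc]

end IntegralPolynomials

section ModularPolynomial

variable {ℓ : ℕ}

lemma aevalAeval_eq_evalEval_map {A B : Type*} [CommSemiring A] [CommSemiring B] [Algebra A B]
    (x y : B) (P : A[X][X]) :
    aevalAeval x y P = (P.map (mapRingHom (algebraMap A B))).evalEval x y := by
  have hhom : (aevalAeval x y : A[X][X] →ₐ[A] B).toRingHom =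
      (evalEvalRingHom x y).comp (mapRingHom (mapRingHom (algebraMap A B))) := by
    ext <;> simp
  exact DFunLike.congr_fun hhom P

lemma isWeberModularPolynomial_iff {Φ : ℤ[X][X]} : IsWeberModularPolynomial ℓ Φ ↔
    Irreducible Φ ∧ Φ.map (mapRingHom (algebraMap ℤ ℂ)) ∈ weberRelations ℓ := by
  simp only [mem_weberRelations, ← aevalAeval_eq_evalEval_map]
  exact ⟨fun h ↦ ⟨h.irreducible, h.relation⟩, fun h ↦ ⟨h.1, h.2⟩⟩

variable [Fact ℓ.Prime]

theorem exists_rat_monic_mem_weberRelations (hN : ℓ.Coprime 48) :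
    ∃ Q : ℚ[X][X], Q.Monic ∧ Q.natDegree = ℓ + 1 ∧
      Q.map (mapRingHom (algebraMap ℚ ℂ)) ∈ weberRelations ℓ := by
  obtain ⟨P, hP, hmonic, hdeg⟩ := exists_monic_mem_weberRelations hN
  simpa only [hdeg] using exists_rat_monic_map_mem_weberRelations (NeZero.ne ℓ) hmonic hP

lemma map_map_algebraMap (P : ℤ[X][X]) :
    (P.map (mapRingHom (algebraMap ℤ ℚ))).map (mapRingHom (algebraMap ℚ ℂ)) =
      P.map (mapRingHom (algebraMap ℤ ℂ)) := by
  rw [Polynomial.map_map, mapRingHom_comp, ← IsScalarTower.algebraMap_eq]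

theorem exists_isWeberModularPolynomial (hN : ℓ.Coprime 48) :
    ∃ Φ, IsWeberModularPolynomial ℓ Φ := by
  obtain ⟨Q, hmonic, -, hQ⟩ := exists_rat_monic_mem_weberRelations hN
  obtain ⟨a, ha, P, hP⟩ := exists_map_eq_C_C_mul ℤ Q
  have hP0 : P ≠ 0 := by
    rintro rfl
    simpa [ha, hmonic.ne_zero] using hP.symm
  have hPmem : P ∈ (weberRelations ℓ).comap (mapRingHom (mapRingHom (algebraMap ℤ ℂ))) := by
    rw [Ideal.mem_comap, coe_mapRingHom, ← map_map_algebraMap, hP, Polynomial.map_mul]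
    exact Ideal.mul_mem_left _ _ hQ
  have := isPrime_weberRelations ℓ
  obtain ⟨Φ, hΦ, hprime⟩ :=
    (Ideal.comap_isPrime (mapRingHom (mapRingHom (algebraMap ℤ ℂ))) (weberRelations ℓ)
      ).exists_mem_prime_of_ne_bot (Submodule.ne_bot_iff _ |>.2 ⟨P, hPmem, hP0⟩)
  exact ⟨Φ, isWeberModularPolynomial_iff.2 ⟨hprime.irreducible, hΦ⟩⟩

theorem IsWeberModularPolynomial.modEq_of_coeff_coeff_ne_zero {Φ : ℤ[X][X]}
    (hΦ : IsWeberModularPolynomial ℓ Φ) (hN : ℓ.Coprime 48) {i j : ℕ}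
    (hij : (Φ.coeff j).coeff i ≠ 0) : i + ℓ * j ≡ ℓ + 1 [MOD 24] := by
  have hℓ := (Fact.out : ℓ.Prime).one_lt
  obtain ⟨hirr, hrel⟩ := isWeberModularPolynomial_iff.1 hΦ
  obtain ⟨Q, hmonic, hdeg, hQ⟩ := exists_rat_monic_mem_weberRelations hN
  have hinj : Function.Injective (mapRingHom (algebraMap ℚ ℂ)) :=
    map_injective _ (algebraMap ℚ ℂ).injective
  have hmonic' := hmonic.map (mapRingHom (algebraMap ℚ ℂ))
  have hdeg' := (hmonic.natDegree_map (mapRingHom (algebraMap ℚ ℂ))).trans hdeg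
  have hdvd : Q ∣ Φ.map (mapRingHom (algebraMap ℤ ℚ)) := by
    rw [← map_dvd_map _ hinj hmonic, map_map_algebraMap]
    exact dvd_of_mem_weberRelations hℓ hmonic' hdeg' hQ hrel
  obtain ⟨c, hc⟩ := exists_eq_C_C_mul_map_of_irreducible hirr (by omega) hdvd
  have hc0 : c ≠ 0 := by
    rintro rfl
    simp [hmonic.ne_zero] at hc
  refine modEq_of_mem_weberRelations_of_monic hℓ hN hQ hmonic' hdeg' ?_
  simpa [hc, hc0] using hij

end ModularPolynomial

theorem mainTheorem5 (ℓ : ℕ) (hℓ : ℓ.Prime) (hN : ℓ.Coprime 48) :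
    (∃ Φ : Polynomial (Polynomial ℤ), IsWeberModularPolynomial ℓ Φ) ∧
    ∀ Φ : Polynomial (Polynomial ℤ), IsWeberModularPolynomial ℓ Φ →
      ∀ i j : ℕ, (Φ.coeff j).coeff i ≠ 0 → i + ℓ * j ≡ ℓ + 1 [MOD 24] := by
  have : Fact ℓ.Prime := ⟨hℓ⟩
  exact ⟨exists_isWeberModularPolynomial hN,
    fun _ hΦ _ _ hij ↦ hΦ.modEq_of_coeff_coeff_ne_zero hN hij⟩
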